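/- Let $\mathbf g=(g_1,g_2,g_3)$ with $g_i\in[0,1/2)$ and $z\in\mathbb C$ with $0<|z|\le 1$, and let $\Psi(\mathbf g,z)$ be the normalised three-qubit state proportional to $(g_x^1\otimes g_x^2\otimes g_x^3)(P_z\otimes 1\otimes 1)|GHZ\rangle$, where $|GHZ\rangle=(|000\rangle+|111\rangle)/\sqrt2$, $P_z=\mathrm{diag}(z,1/z)$, and $g_x^i$ is the positive square root of $\tfrac12 1+g_i\sigma_x$ (up to local unitaries (LU), any $g_x^i$ with $(g_x^i)^\dagger g_x^i=\tfrac12 1+g_i\sigma_x$ gives the same state). A state $\psi$ *reaches* $\varphi$ if some LOCC protocol transforms $\psi$ into $\varphi$ deterministically. Let $M_a(\psi)$ be the set of LU classes of genuinely entangled three-qubit pure states reached by $\psi$, and $M_s(\psi)$ the set of LU classes of genuinely entangled three-qubit pure states that reach $\psi$. The maximally entangled set (MES) consists of the genuinely entangled three-qubit pure states that are not reached by any LU-inequivalent genuinely entangled three-qubit pure state. Call $(\mathbf g,z)$, and the state $\Psi(\mathbf g,z)$, *generic* if $g_i>0$ for all $i$ and $\Psi(\mathbf g,z)$ is not in the MES.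 For a set $S$ of LU classes let $$\mu(S)=\int_{[0,1/2)^3}\#\{c\in S:\ c \text{ is the LU class of } \Psi(\mathbf h,z') \text{ for some } 0<|z'|\le1\}\,dh_1\,dh_2\,dh_3,$$ and let $V_a(\psi)=\mu(M_a(\psi))$ and $V_s(\psi)=\mu(M_s(\psi))$ be the accessible and the source volume. Let $V_a^{\sup}$ and $V_s^{\sup}$ be their suprema over all generic states, and put $E_a=V_a/V_a^{\sup}$ and $E_s=1-V_s/V_s^{\sup}$. Then, for every generic state $\Psi(\mathbf g,z)$, both volumes are finite and $$V_a(\Psi(\mathbf g,z))=\left(\tfrac12-g_1\right)\left(\tfrac12-g_2\right)\left(\tfrac12-g_3\right),$$ $$V_s(\Psi(\mathbf g,z))=G\left(1+f_z\left[\log f_z\left(1-\tfrac12\log f_z\right)-1\right]\right),$$ where $G=g_1g_2g_3$, $f_z=\dfrac{2|\mathrm{Re}(z^2)|}{1+|z|^4}$, $\log$ is the natural logarithm, and the product $f_z[\cdots]$ is read as $0$ if $f_z=0$ (that is, $0\log 0=0$). Moreover $V_a^{\sup}=V_s^{\sup}=\tfrac18$, so that for every generic state $E_a=8V_a$ and $E_s=1-8V_s$.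 -/

import Mathlib

open scoped Matrix ENNReal

noncomputable section

namespace ThreeQubit

/-! ### Three-party Hilbert spaces and local operators -/

/-- Labels of the product basis of `ℂ^{d 0} ⊗ ℂ^{d 1} ⊗ ℂ^{d 2}`. -/
abbrev Idx (d : Fin 3 → ℕ) : Type := (i : Fin 3) → Fin (d i)

/-- Vectors of `ℂ^{d 0} ⊗ ℂ^{d 1} ⊗ ℂ^{d 2}`, given by their coordinates in the product basis. -/
abbrev Ket (d : Fin 3 → ℕ) : Type := Idx d → ℂ

/-- Operators on `ℂ^{d 0} ⊗ ℂ^{d 1} ⊗ ℂ^{d 2}`. -/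
abbrev Op (d : Fin 3 → ℕ) : Type := Matrix (Idx d) (Idx d) ℂ

/-- Three qubits. -/
abbrev qubits : Fin 3 → ℕ := fun _ => 2

/-- The product operator `K 0 ⊗ K 1 ⊗ K 2`. -/
def tensorOp {d e : Fin 3 → ℕ} (K : (i : Fin 3) → Matrix (Fin (e i)) (Fin (d i)) ℂ) :
    Matrix (Idx e) (Idx d) ℂ :=
  Matrix.of fun a b => ∏ i, K i (a i) (b i)

/-- The operator `|ψ⟩⟨ψ|`. -/
def proj {d : Fin 3 → ℕ} (ψ : Ket d) : Op d := Matrix.vecMulVec ψ (star ψ)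

/-! ### Local operations and classical communication -/

/-- Finite-round LOCC protocols of three parties, from local dimensions `d` to local dimensions `e`.
In each round some party `j` performs a generalised measurement with finitely many outcomes `k` and
Kraus operators `K k j`, and announces the outcome; the other parties may react with local
isometries `K k i` (for instance local unitaries, or the addition of ancillas). The rest of the
protocol may depend on the outcome, and so may the intermediate local dimensions `m k`. -/
inductive LOCC (e : Fin 3 → ℕ) : (Fin 3 → ℕ) → Type
  | leaf : LOCC e e
  | round {d : Fin 3 → ℕ} (j : Fin 3) (n : ℕ) (m : Fin n → Fin 3 → ℕ)
      (K : (k : Fin n) → (i : Fin 3) → Matrix (Fin (m k i)) (Fin (d i)) ℂ)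
      (complete : ∑ k, (K k j)ᴴ * K k j = 1)
      (isometry : ∀ k i, i ≠ j → (K k i)ᴴ * K k i = 1)
      (next : (k : Fin n) → LOCC e (m k)) : LOCC e d

/-- The channel implemented by an LOCC protocol: the sum over all branches. -/
def LOCC.apply {e : Fin 3 → ℕ} : {d : Fin 3 → ℕ} → LOCC e d → Op d → Op e
  | _, .leaf, ρ => ρ
  | _, .round _ _ _ K _ _ next, ρ =>
      ∑ k, (next k).apply (tensorOp (K k) * ρ * (tensorOp (K k))ᴴ)

/-- `ψ` can reach `φ`: some LOCC protocol transforms `ψ` into `φ` deterministically. -/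
def Reaches (ψ φ : Ket qubits) : Prop :=
  ∃ P : LOCC qubits qubits, P.apply (proj ψ) = proj φ

/-! ### Local unitary equivalence -/

/-- `φ = (U 0 ⊗ U 1 ⊗ U 2) ψ` with unitary `U i`. -/
def LUEquiv (ψ φ : Ket qubits) : Prop :=
  ∃ U : Fin 3 → Matrix.unitaryGroup (Fin 2) ℂ,
    φ = tensorOp (d := qubits) (e := qubits) (fun i => (U i : Matrix (Fin 2) (Fin 2) ℂ)) *ᵥ ψ

theorem tensorOp_one :
    tensorOp (d := qubits) (e := qubits) (fun _ => (1 : Matrix (Fin 2) (Fin 2) ℂ)) = 1 := by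
  ext a b
  simp only [tensorOp, Matrix.of_apply, Matrix.one_apply]
  rw [Finset.prod_ite_zero]
  simp [funext_iff]

theorem tensorOp_mul (A B : Fin 3 → Matrix (Fin 2) (Fin 2) ℂ) :
    tensorOp (d := qubits) (e := qubits) A * tensorOp (d := qubits) (e := qubits) B
      = tensorOp (d := qubits) (e := qubits) (fun i => A i * B i) := by
  ext a b
  simp only [tensorOp, Matrix.of_apply, Matrix.mul_apply, ← Finset.prod_mul_distrib]
  exact (Fintype.prod_sum (fun i k => A i (a i) k * B i k (b i))).symm

theorem luEquiv_equivalence : Equivalence LUEquiv where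
  refl ψ := ⟨1, by simp [tensorOp_one]⟩
  symm := by
    rintro ψ φ ⟨U, rfl⟩
    refine ⟨U⁻¹, ?_⟩
    have h : ∀ i, ((U⁻¹ i : Matrix.unitaryGroup (Fin 2) ℂ) : Matrix (Fin 2) (Fin 2) ℂ)
        * (U i : Matrix (Fin 2) (Fin 2) ℂ) = 1 := fun i => by
      rw [← Matrix.UnitaryGroup.mul_val]; simp
    rw [Matrix.mulVec_mulVec, tensorOp_mul]
    simp only [h, tensorOp_one, Matrix.one_mulVec]
  trans := by
    rintro ψ φ χ ⟨U, rfl⟩ ⟨V, rfl⟩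
    exact ⟨V * U, by rw [Matrix.mulVec_mulVec, tensorOp_mul]; rfl⟩

/-- Local unitary equivalence as a setoid. -/
def luSetoid : Setoid (Ket qubits) := ⟨LUEquiv, luEquiv_equivalence⟩

/-- LU-equivalence classes of three-qubit vectors. -/
abbrev LUClass : Type := Quotient luSetoid

/-- The LU-equivalence class of a vector. -/
def luClass (ψ : Ket qubits) : LUClass := Quotient.mk luSetoid ψ

/-! ### Genuinely entangled states, accessible and source sets, the maximally entangled set -/

/-- `ψ` is a product across the cut between qubit `i` and the other two qubits. -/
def IsProductAcross (ψ : Ket qubits) (i : Fin 3) : Prop :=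
  ∃ (χ : Fin 2 → ℂ) (ω : ({k : Fin 3 // k ≠ i} → Fin 2) → ℂ),
    ∀ a : Idx qubits, ψ a = χ (a i) * ω (fun k => a k)

/-- Genuinely tripartite entangled (normalised, pure) three-qubit states. -/
def IsEntangledState (ψ : Ket qubits) : Prop :=
  ∑ a, ‖ψ a‖ ^ 2 = 1 ∧ ∀ i, ¬ IsProductAcross ψ i

/-- The accessible set `M_a(ψ)`. -/
def accessibleSet (ψ : Ket qubits) : Set LUClass :=
  {c | ∃ φ, IsEntangledState φ ∧ Reaches ψ φ ∧ luClass φ = c}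

/-- The source set `M_s(ψ)`. -/
def sourceSet (ψ : Ket qubits) : Set LUClass :=
  {c | ∃ φ, IsEntangledState φ ∧ Reaches φ ψ ∧ luClass φ = c}

/-- The maximally entangled set of three qubits: the genuinely entangled states that cannot be
reached from any other (that is, LU-inequivalent) genuinely entangled state. -/
def InMES (ψ : Ket qubits) : Prop :=
  IsEntangledState ψ ∧ ∀ φ, IsEntangledState φ → Reaches φ ψ → LUEquiv φ ψ

/-! ### The GHZ class -/

/-- The positive square root of `(1/2) 1 + x σ_x`, for `|x| ≤ 1/2`. Any other `A` with
`Aᴴ A = (1/2) 1 + x σ_x` is a unitary times this one. -/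
def gMatrix (x : ℝ) : Matrix (Fin 2) (Fin 2) ℂ :=
  let p : ℂ := (((√(1 / 2 + x) + √(1 / 2 - x)) / 2 : ℝ) : ℂ)
  let q : ℂ := (((√(1 / 2 + x) - √(1 / 2 - x)) / 2 : ℝ) : ℂ)
  !![p, q; q, p]

theorem gMatrix_spec (x : ℝ) (hx : |x| ≤ 1 / 2) :
    (gMatrix x)ᴴ * gMatrix x
      = (1 / 2 : ℂ) • (1 : Matrix (Fin 2) (Fin 2) ℂ) + (x : ℂ) • !![0, 1; 1, 0] := by
  obtain ⟨h1, h2⟩ := abs_le.mp hx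
  have e1 := Real.mul_self_sqrt (show 0 ≤ 1 / 2 + x by linarith)
  have e2 := Real.mul_self_sqrt (show 0 ≤ 1 / 2 - x by linarith)
  unfold gMatrix
  generalize √(1 / 2 + x) = s at *
  generalize √(1 / 2 - x) = t at *
  have d : ((s + t) / 2) * ((s + t) / 2) + ((s - t) / 2) * ((s - t) / 2) = 1 / 2 := by linarith
  have o : ((s + t) / 2) * ((s - t) / 2) + ((s - t) / 2) * ((s + t) / 2) = x := by linarith
  have d' := congrArg (fun r : ℝ => (r : ℂ)) d
  have o' := congrArg (fun r : ℝ => (r : ℂ)) o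
  push_cast at d' o'
  ext i j
  fin_cases i <;> fin_cases j <;>
    simp [Matrix.mul_apply, Fin.sum_univ_two, Complex.conj_ofReal, map_ofNat] <;>
    first
      | linear_combination d'
      | linear_combination o'

/-- The vector `|GHZ⟩ = (|000⟩ + |111⟩)/√2`. -/
def ghz : Ket qubits := fun a =>
  if ∀ i, a i = 0 then ((1 / √2 : ℝ) : ℂ) else if ∀ i, a i = 1 then ((1 / √2 : ℝ) : ℂ) else 0

/-- `P_z = diag(z, 1/z)`. -/
def pMatrix (z : ℂ) : Matrix (Fin 2) (Fin 2) ℂ := !![z, 0; 0, 1 / z]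

/-- `(g_x^1 ⊗ g_x^2 ⊗ g_x^3) (P_z ⊗ 1 ⊗ 1) |GHZ⟩`, not yet normalised. -/
def ghzVector (g : Fin 3 → ℝ) (z : ℂ) : Ket qubits :=
  tensorOp (d := qubits) (e := qubits) (fun i => gMatrix (g i)) *ᵥ
    (tensorOp (d := qubits) (e := qubits) (fun i => if i = 0 then pMatrix z else 1) *ᵥ ghz)

/-- The normalised GHZ-class state `Ψ(g, z)`. -/
def ghzState (g : Fin 3 → ℝ) (z : ℂ) : Ket qubits :=
  ((1 / √(∑ a, ‖ghzVector g z a‖ ^ 2) : ℝ) : ℂ) • ghzVector g z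

/-- Generic GHZ-class states: all `g i` are nonzero and `Ψ(g, z)` is not in the maximally entangled
set. -/
def IsGeneric (g : Fin 3 → ℝ) (z : ℂ) : Prop :=
  (∀ i, 0 < g i ∧ g i < 1 / 2) ∧ z ≠ 0 ∧ ‖z‖ ≤ 1 ∧ ¬ InMES (ghzState g z)

/-! ### Volumes and the entanglement measures -/

/-- The three-dimensional measure of a set `S` of LU classes in the GHZ class: Lebesgue measure in
the parameters `h ∈ [0, 1/2)³`, each `h` counted with the number of LU classes of states `Ψ(h, z')`
that belong to `S`. -/
def volume3 (S : Set LUClass) : ℝ≥0∞ :=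
  ∫⁻ h in Set.univ.pi (fun _ : Fin 3 => Set.Ico (0 : ℝ) (1 / 2)),
    (({c ∈ S | ∃ z : ℂ, z ≠ 0 ∧ ‖z‖ ≤ 1 ∧ luClass (ghzState h z) = c}.encard : ℕ∞) : ℝ≥0∞)

/-- The accessible volume `V_a`. -/
def accessibleVolume (ψ : Ket qubits) : ℝ≥0∞ := volume3 (accessibleSet ψ)

/-- The source volume `V_s`. -/
def sourceVolume (ψ : Ket qubits) : ℝ≥0∞ := volume3 (sourceSet ψ)

/-- `V_a^sup`, the supremum of the accessible volume over the generic states. -/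
def accessibleVolumeSup : ℝ≥0∞ :=
  ⨆ (g : Fin 3 → ℝ) (z : ℂ) (_ : IsGeneric g z), accessibleVolume (ghzState g z)

/-- `V_s^sup`, the supremum of the source volume over the generic states. -/
def sourceVolumeSup : ℝ≥0∞ :=
  ⨆ (g : Fin 3 → ℝ) (z : ℂ) (_ : IsGeneric g z), sourceVolume (ghzState g z)

/-- The accessible entanglement `E_a = V_a / V_a^sup`. -/
def accessibleEntanglement (ψ : Ket qubits) : ℝ :=
  (accessibleVolume ψ / accessibleVolumeSup).toReal

/-- The source entanglement `E_s = 1 - V_s / V_s^sup`. -/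
def sourceEntanglement (ψ : Ket qubits) : ℝ :=
  1 - (sourceVolume ψ / sourceVolumeSup).toReal

/-- `f_z = 2 |Re z²| / (1 + |z|⁴)`. -/
def fParam (z : ℂ) : ℝ := 2 * |(z ^ 2).re| / (1 + ‖z‖ ^ 4)

end ThreeQubit

end

open ThreeQubit

/-!
A state `Ψ(g, z)` is, up to a scalar, `(g_x^1 ⊗ g_x^2 ⊗ g_x^3) (α |000⟩ + β |111⟩)` (`gVec g α
β`), a superposition of two product vectors whose local overlaps are `2 g i`. Put `C = g 0 * g 1 *
g 2`. The proof determines all conversions between such states. Up to local unitaries, the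
coefficients matter only through `|α|² + |β|²`, `Re (ᾱ β)` and, up to a common sign, `|α|² - |β|²`
and `Im (ᾱ β)`.

*Necessity.* An LOCC protocol yields a complete family of product Kraus operators
(`LOCC.exists_kraus`). Since the decomposition into two product vectors is unique, each operator
maps the two terms of the source to the two terms of the target, in order or exchanged
(`diagonal_or_antidiagonal`). Comparing matrix elements in the completeness relation gives
`Reaches.necessary`: no local parameter decreases, `|α|² + |β|²` and `C Re (ᾱ β)` are conserved,
and `|α|² - |β|²` and `C Im (ᾱ β)` of the source are `r` times those of the target, where `r` is
the difference of the probabilities of the two kinds of branches. Branches of probability zero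
have to be excluded here; this uses the tree structure of LOCC and not only separability.

*Sufficiency.* One party changes its parameter by a two-outcome measurement, one outcome keeping
the order of the two terms and the other exchanging them (`reaches_update`). Three such steps
realise every conversion between positive local parameters that the necessary conditions allow,
provided that `|α|² - |β|²` and `Im (ᾱ β)` do not both vanish (`reaches_of_coeffConvertible`); if
they do vanish, the state lies in the maximally entangled set (`inMES_gVec`). Both the source and
the target are unique up to local unitaries once the local parameters are fixed.

*Volumes.* From a generic state exactly one class with parameters `h` is accessible if `g ≤ h`,
and none otherwise. If a source has parameters `h ≤ g`, its `Re (ᾱ β)` is multiplied by `∏ g / ∏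
h`; outside a null set of `h`, such coefficients exist if and only if `∏ h > f_z ∏ g`. The volumes
are therefore those of a box and of the part of a box where the product of the coordinates exceeds
a constant.
-/

namespace ThreeQubit

/-! ### Product operators -/

section TensorOp

variable {d e f : Fin 3 → ℕ}

theorem tensorOp_apply (K : (i : Fin 3) → Matrix (Fin (e i)) (Fin (d i)) ℂ) (a : Idx e)
    (b : Idx d) : tensorOp K a b = ∏ i, K i (a i) (b i) := rfl

theorem tensorOp_one_eq (d : Fin 3 → ℕ) :
    tensorOp (d := d) (e := d) (fun _ => 1) = 1 := by
  ext a b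
  simp only [tensorOp, Matrix.of_apply, Matrix.one_apply]
  rw [Finset.prod_ite_zero]
  simp [funext_iff]

theorem tensorOp_mul_tensorOp (A : (i : Fin 3) → Matrix (Fin (f i)) (Fin (e i)) ℂ)
    (B : (i : Fin 3) → Matrix (Fin (e i)) (Fin (d i)) ℂ) :
    tensorOp A * tensorOp B = tensorOp fun i => A i * B i := by
  ext a b
  simp only [tensorOp, Matrix.of_apply, Matrix.mul_apply, ← Finset.prod_mul_distrib]
  exact (Fintype.prod_sum (fun i k => A i (a i) k * B i k (b i))).symm

theorem tensorOp_conjTranspose (K : (i : Fin 3) → Matrix (Fin (e i)) (Fin (d i)) ℂ) :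
    (tensorOp K)ᴴ = tensorOp fun i => (K i)ᴴ := by
  ext a b
  simp [tensorOp, Matrix.conjTranspose_apply]

theorem tensorOp_eq_zero {K : (i : Fin 3) → Matrix (Fin (e i)) (Fin (d i)) ℂ} {j : Fin 3}
    (h : K j = 0) : tensorOp K = 0 := by
  ext a b
  refine Finset.prod_eq_zero (f := fun i => K i (a i) (b i)) (Finset.mem_univ j) ?_
  rw [h, Matrix.zero_apply]

/-- A one-party measurement, supplemented by isometries of the other parties, is complete. -/
theorem sum_conjTranspose_mul_tensorOp {n : ℕ} {m : Fin n → Fin 3 → ℕ} (j : Fin 3)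
    (K : (k : Fin n) → (i : Fin 3) → Matrix (Fin (m k i)) (Fin (d i)) ℂ)
    (complete : ∑ k, (K k j)ᴴ * K k j = 1)
    (isometry : ∀ k i, i ≠ j → (K k i)ᴴ * K k i = 1) :
    ∑ k, (tensorOp (K k))ᴴ * tensorOp (K k) = 1 := by
  have key : ∀ k, (tensorOp (K k))ᴴ * tensorOp (K k)
      = Matrix.of fun a b : Idx d => ((K k j)ᴴ * K k j) (a j) (b j)
        * ∏ i ∈ Finset.univ.erase j, (1 : Matrix (Fin (d i)) (Fin (d i)) ℂ) (a i) (b i) := by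
    intro k
    rw [tensorOp_conjTranspose, tensorOp_mul_tensorOp]
    ext a b
    rw [tensorOp_apply, ← Finset.mul_prod_erase _ _ (Finset.mem_univ j), Matrix.of_apply]
    congr 1
    refine Finset.prod_congr rfl fun i hi => ?_
    rw [isometry k i (Finset.ne_of_mem_erase hi)]
  ext a b
  rw [← tensorOp_one_eq d, tensorOp_apply, ← Finset.mul_prod_erase _ _ (Finset.mem_univ j),
    ← complete]
  simp only [key, Matrix.sum_apply, Matrix.of_apply, Finset.sum_mul]

theorem mul_proj_mul_conjTranspose (M : Matrix (Idx e) (Idx d) ℂ) (ψ : Ket d) :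
    M * proj ψ * Mᴴ = proj (M *ᵥ ψ) := by
  rw [proj, proj, Matrix.mul_vecMulVec, Matrix.vecMulVec_mul, Matrix.star_mulVec]

end TensorOp

/-! ### Products across a cut -/

/-- A product operator acting on a single qubit. -/
theorem tensorOp_update_mulVec (j : Fin 3) (M : Matrix (Fin 2) (Fin 2) ℂ) (ψ : Ket qubits)
    (a : Idx qubits) :
    (tensorOp (d := qubits) (e := qubits) (Function.update (fun _ => 1) j M) *ᵥ ψ) a
      = ∑ x, M (a j) x * ψ (Function.update a j x) := by
  refine (Fintype.sum_of_injective (fun x : Fin 2 => (Function.update a j x : Idx qubits))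
    (fun x y h => by simpa using congrFun h j) (fun x => M (a j) x * ψ (Function.update a j x))
    (fun b => tensorOp (d := qubits) (e := qubits) (Function.update (fun _ => 1) j M) a b * ψ b)
    (fun b hb => ?_) (fun x => ?_)).symm
  · have : ∃ i, i ≠ j ∧ a i ≠ b i := by
      by_contra! hc
      refine hb ⟨b j, ?_⟩
      ext1 i
      by_cases hi : i = j
      · subst hi; simp
      · simpa [hi] using hc i hi
    obtain ⟨i, hij, hab⟩ := this
    rw [tensorOp_apply, Finset.prod_eq_zero (Finset.mem_univ i), zero_mul]
    rw [Function.update_of_ne hij, Matrix.one_apply_ne hab]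
  · congr 1
    rw [tensorOp_apply, ← Finset.mul_prod_erase _ _ (Finset.mem_univ j), Finset.prod_eq_one]
    · simp
    · intro i hi
      have := Finset.ne_of_mem_erase hi
      simp [this]

/-- Two linearly dependent vectors are multiples of a common one. -/
theorem exists_factor_of_dependent {X : Type*} {p q : X → ℂ} {v : Fin 2 → ℂ} (hv : v ≠ 0)
    (h : ∀ x, v 0 * p x + v 1 * q x = 0) :
    ∃ (χ : Fin 2 → ℂ) (η : X → ℂ), (∀ x, p x = χ 0 * η x) ∧ ∀ x, q x = χ 1 * η x := by
  by_cases h1 : v 1 = 0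
  · have h0 : v 0 ≠ 0 := fun h0 => hv (by ext i; fin_cases i <;> simp [h0, h1])
    refine ⟨![0, 1], q, fun x => ?_, fun x => by simp⟩
    have := h x
    simp_all
  · refine ⟨![1, - v 0 / v 1], p, fun x => by simp, fun x => ?_⟩
    have := h x
    simp only [Matrix.cons_val_one, Matrix.cons_val_fin_one]
    field_simp
    linear_combination this

theorem isProductAcross_of_dependent {ψ : Ket qubits} {j : Fin 3} {v : Fin 2 → ℂ} (hv : v ≠ 0)
    (h : ∀ a : Idx qubits, ∑ x, v x * ψ (Function.update a j x) = 0) : IsProductAcross ψ j := by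
  obtain ⟨χ, η, h0, h1⟩ := exists_factor_of_dependent
    (p := fun a : Idx qubits => ψ (Function.update a j 0))
    (q := fun a : Idx qubits => ψ (Function.update a j 1)) hv
    (fun a => by simpa [Fin.sum_univ_two] using h a)
  refine ⟨χ, fun r => η fun k => if hk : k ≠ j then r ⟨k, hk⟩ else 0, fun a => ?_⟩
  have e : ∀ x, Function.update
      (fun k => if hk : k ≠ j then (fun l : {k : Fin 3 // k ≠ j} => a l) ⟨k, hk⟩ else 0 :
        Idx qubits) j x = Function.update a j x := by
    intro x
    ext1 k
    by_cases hk : k = j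
    · subst hk; simp
    · simp [hk]
  have g0 := h0 fun k => if hk : k ≠ j then (fun l : {k : Fin 3 // k ≠ j} => a l) ⟨k, hk⟩ else 0
  have g1 := h1 fun k => if hk : k ≠ j then (fun l : {k : Fin 3 // k ≠ j} => a l) ⟨k, hk⟩ else 0
  rw [e] at g0 g1
  rcases (by decide : ∀ x : Fin 2, x = 0 ∨ x = 1) (a j) with hx | hx
  · rw [hx, ← g0, ← hx, Function.update_eq_self]
  · rw [hx, ← g1, ← hx, Function.update_eq_self]

/-- If the other parties act injectively, a product operator annihilates a vector that is entangled
with qubit `j` only if it vanishes on that qubit. -/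
theorem eq_zero_of_tensorOp_mulVec_eq_zero {d : Fin 3 → ℕ} {ψ : Ket qubits} {j : Fin 3}
    (hψ : ¬ IsProductAcross ψ j) (B : (i : Fin 3) → Matrix (Fin (d i)) (Fin 2) ℂ)
    (hB : ∀ i, i ≠ j → ∃ L : Matrix (Fin 2) (Fin (d i)) ℂ, L * B i = 1)
    (h : tensorOp (d := qubits) B *ᵥ ψ = 0) : B j = 0 := by
  by_contra hne
  obtain ⟨r, hr⟩ : ∃ r, B j r ≠ 0 := by
    by_contra! hc
    exact hne (by ext r c; rw [hc r]; rfl)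
  have : ∃ L : (i : Fin 3) → Matrix (Fin 2) (Fin (d i)) ℂ, ∀ i, i ≠ j → L i * B i = 1 := by
    refine ⟨fun i => if hi : i ≠ j then (hB i hi).choose else 0, fun i hi => ?_⟩
    simp only [ne_eq, hi, not_false_eq_true, dite_true]
    exact (hB i hi).choose_spec
  obtain ⟨L, hL⟩ := this
  let N : Matrix (Fin 2) (Fin (d j)) ℂ := Matrix.of fun _ y => if y = r then 1 else 0
  have hN : ∀ a b, (N * B j) a b = B j r b := by
    intro a b
    simp [N, Matrix.mul_apply]
  apply hψ
  refine isProductAcross_of_dependent (v := B j r) hr fun a => ?_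
  have key : (fun i => Function.update L j N i * B i)
      = Function.update (fun _ => (1 : Matrix (Fin 2) (Fin 2) ℂ)) j (N * B j) := by
    ext1 i
    by_cases hi : i = j
    · subst hi; simp
    · rw [Function.update_of_ne hi, Function.update_of_ne hi, hL i hi]
  have h2 := congrArg (fun v => (tensorOp (d := d) (e := qubits) (Function.update L j N) *ᵥ v) a) h
  simp only [Matrix.mulVec_mulVec, Matrix.mulVec_zero] at h2
  rw [tensorOp_mul_tensorOp] at h2
  have h3 := tensorOp_update_mulVec j (N * B j) ψ a
  rw [← key] at h3
  simp only [hN] at h3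
  rw [← h3]
  exact h2

/-- A singular operator on qubit `j` disentangles it. -/
theorem isProductAcross_of_det_eq_zero (K : Fin 3 → Matrix (Fin 2) (Fin 2) ℂ) (ψ : Ket qubits)
    (j : Fin 3) (h : (K j).det = 0) :
    IsProductAcross (tensorOp (d := qubits) (e := qubits) K *ᵥ ψ) j := by
  obtain ⟨v, hv, hK⟩ := Matrix.exists_vecMul_eq_zero_iff.mpr h
  obtain ⟨χ, η, h0, h1⟩ := exists_factor_of_dependent (p := K j 0) (q := K j 1) hv (fun x => by
    have := congrFun hK x
    simpa [Matrix.vecMul, dotProduct, Fin.sum_univ_two] using this)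
  refine ⟨χ, fun r => ∑ b : Idx qubits, η (b j) *
    (∏ l : {k : Fin 3 // k ≠ j}, K l (r l) (b l)) * ψ b, fun a => ?_⟩
  have hk : ∀ x, K j (a j) x = χ (a j) * η x := by
    intro x
    rcases (by decide : ∀ x : Fin 2, x = 0 ∨ x = 1) (a j) with hx | hx <;> rw [hx]
    exacts [h0 x, h1 x]
  simp only [Matrix.mulVec, dotProduct, Finset.mul_sum]
  refine Finset.sum_congr rfl fun b _ => ?_
  rw [tensorOp_apply, Fintype.prod_eq_mul_prod_subtype_ne (fun i => K i (a i) (b i)) j, hk]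
  ring

/-- Being a product across a cut is preserved by product operators. -/
theorem IsProductAcross.tensorOp_mulVec {ψ : Ket qubits} {j : Fin 3} (h : IsProductAcross ψ j)
    (K : Fin 3 → Matrix (Fin 2) (Fin 2) ℂ) :
    IsProductAcross (tensorOp (d := qubits) (e := qubits) K *ᵥ ψ) j := by
  obtain ⟨χ, ω, h⟩ := h
  refine ⟨fun x => ∑ y, K j x y * χ y,
    fun r => ∑ s : {k : Fin 3 // k ≠ j} → Fin 2, 
      (∏ l : {k : Fin 3 // k ≠ j}, K l (r l) (s l)) * ω s, fun a => ?_⟩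
  simp only [Matrix.mulVec, dotProduct]
  rw [Finset.sum_mul_sum, ← Fintype.sum_prod_type', ← (Equiv.funSplitAt j (Fin 2)).sum_comp]
  refine Finset.sum_congr rfl fun b _ => ?_
  rw [tensorOp_apply, Fintype.prod_eq_mul_prod_subtype_ne (fun i => K i (a i) (b i)) j, h]
  simp only [Equiv.funSplitAt, Equiv.piSplitAt_apply]
  ring

theorem IsProductAcross.smul {ψ : Ket qubits} {j : Fin 3} (h : IsProductAcross ψ j) (c : ℂ) :
    IsProductAcross (c • ψ) j := by
  obtain ⟨χ, ω, h⟩ := h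
  exact ⟨c • χ, ω, fun a => by simp [h a, mul_assoc]⟩

/-! ### Kraus families of LOCC protocols -/

/-- Every LOCC protocol is a separable map. The last clause concerns branches of probability zero:
if every branch that occurs with nonzero probability acts injectively on each party, then the other
branches have vanishing Kraus operators. It fails for general separable maps. The operators `A`
stand for the part of the protocol that has already been carried out. -/
theorem LOCC.exists_kraus {e d : Fin 3 → ℕ} (P : LOCC e d) :
    ∃ (ι : Type) (_ : Fintype ι) (K : ι → (i : Fin 3) → Matrix (Fin (e i)) (Fin (d i)) ℂ),
      ∑ k, (tensorOp (K k))ᴴ * tensorOp (K k) = 1 ∧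
      (∀ ρ, P.apply ρ = ∑ k, tensorOp (K k) * ρ * (tensorOp (K k))ᴴ) ∧
      ∀ ψ : Ket qubits, (∀ i, ¬ IsProductAcross ψ i) →
        ∀ A : (i : Fin 3) → Matrix (Fin (d i)) (Fin 2) ℂ,
        tensorOp (d := qubits) A *ᵥ ψ ≠ 0 →
        (∀ k, tensorOp (K k) *ᵥ (tensorOp (d := qubits) A *ᵥ ψ) = 0 ∨
          ∀ i, ∃ L : Matrix (Fin 2) (Fin (e i)) ℂ, L * (K k i * A i) = 1) →
        ∀ k, tensorOp (K k) *ᵥ (tensorOp (d := qubits) A *ᵥ ψ) ≠ 0 ∨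
          tensorOp (K k) * tensorOp (d := qubits) A = 0 := by
  induction P with
  | leaf =>
    refine ⟨Unit, inferInstance, fun _ _ => 1, ?_, ?_, ?_⟩
    · simp [tensorOp_one_eq]
    · intro ρ
      simp [tensorOp_one_eq, LOCC.apply]
    · intro ψ _ A hA _ _
      left
      rwa [tensorOp_one_eq, Matrix.one_mulVec]
  | @round d j n m K complete isometry next ih =>
    choose ι hι L hL1 hL2 hL3 using ih
    have comp : ∀ k l, tensorOp (fun i => L k l i * K k i) = tensorOp (L k l) * tensorOp (K k) :=
      fun k l => (tensorOp_mul_tensorOp _ _).symm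
    have hsum : ∑ x : Σ k, ι k, (tensorOp (fun i => L x.1 x.2 i * K x.1 i))ᴴ *
        tensorOp (fun i => L x.1 x.2 i * K x.1 i) = 1 := by
      rw [Fintype.sum_sigma, ← sum_conjTranspose_mul_tensorOp j K complete isometry]
      refine Finset.sum_congr rfl fun k _ => ?_
      simp only [comp, Matrix.conjTranspose_mul, Matrix.mul_assoc]
      rw [← Matrix.mul_sum]
      simp only [← Matrix.mul_assoc]
      rw [← Matrix.sum_mul, hL1, Matrix.one_mul]
    refine ⟨Σ k, ι k, inferInstance, fun x i => L x.1 x.2 i * K x.1 i, hsum, ?_, ?_⟩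
    · intro ρ
      rw [LOCC.apply, Fintype.sum_sigma]
      refine Finset.sum_congr rfl fun k _ => ?_
      simp only [hL2, comp, Matrix.conjTranspose_mul, Matrix.mul_assoc]
    · rintro ψ hψ A hA h ⟨k, l⟩
      simp only [comp] at h ⊢
      have hA' : tensorOp (d := qubits) (fun i => K k i * A i)
          = tensorOp (K k) * tensorOp (d := qubits) A := (tensorOp_mul_tensorOp _ _).symm
      by_cases h0 : tensorOp (K k) *ᵥ (tensorOp (d := qubits) A *ᵥ ψ) = 0
      · right
        -- Some branch has nonzero probability, so the operators `A i` are injective.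
        obtain ⟨⟨k', l'⟩, hx⟩ : ∃ x : Σ k, ι k,
            (tensorOp (L x.1 x.2) * tensorOp (K x.1)) *ᵥ (tensorOp (d := qubits) A *ᵥ ψ) ≠ 0 := by
          by_contra! hc
          apply hA
          have := congrArg (fun M => M *ᵥ (tensorOp (d := qubits) A *ᵥ ψ)) hsum
          simp only [comp, Matrix.sum_mulVec, Matrix.one_mulVec] at this
          rw [← this]
          refine Finset.sum_eq_zero fun x _ => ?_
          rw [← Matrix.mulVec_mulVec, hc x, Matrix.mulVec_zero]
        have hinj := (h ⟨k', l'⟩).resolve_left hx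
        have hB : K k j * A j = 0 := by
          refine eq_zero_of_tensorOp_mulVec_eq_zero (hψ j) (fun i => K k i * A i)
            (fun i hi => ?_) ?_
          · obtain ⟨R, hR⟩ := hinj i
            refine ⟨R * (L k' l' i * K k' i) * (K k i)ᴴ, ?_⟩
            rw [Matrix.mul_assoc, ← Matrix.mul_assoc (K k i)ᴴ, isometry k i hi, Matrix.one_mul,
              Matrix.mul_assoc]
            exact hR
          · rw [hA', ← Matrix.mulVec_mulVec, h0]
        rw [Matrix.mul_assoc, ← hA',
          tensorOp_eq_zero (K := fun i => K k i * A i) (j := j) hB, Matrix.mul_zero]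
      · have := hL3 k ψ hψ (fun i => K k i * A i)
          (by rwa [hA', ← Matrix.mulVec_mulVec]) (fun l => by
            rcases h ⟨k, l⟩ with h | h
            · left
              rwa [hA', ← Matrix.mulVec_mulVec, Matrix.mulVec_mulVec]
            · right
              intro i
              obtain ⟨R, hR⟩ := h i
              exact ⟨R, by rw [← hR, Matrix.mul_assoc]⟩) l
        simpa only [hA', ← Matrix.mulVec_mulVec, Matrix.mul_assoc] using this

/-- Sequential composition of LOCC protocols. -/
def LOCC.comp {e f : Fin 3 → ℕ} (Q : LOCC f e) : {d : Fin 3 → ℕ} → LOCC e d → LOCC f d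
  | _, .leaf => Q
  | _, .round j n m K complete isometry next =>
      .round j n m K complete isometry fun k => LOCC.comp Q (next k)

theorem LOCC.apply_sum {e d : Fin 3 → ℕ} (P : LOCC e d) {ι : Type*} (s : Finset ι)
    (ρ : ι → Op d) : P.apply (∑ k ∈ s, ρ k) = ∑ k ∈ s, P.apply (ρ k) := by
  obtain ⟨κ, _, K, -, hK, -⟩ := P.exists_kraus
  simp only [hK, Matrix.mul_sum, Matrix.sum_mul]
  exact Finset.sum_comm

theorem LOCC.apply_comp {e f d : Fin 3 → ℕ} (Q : LOCC f e) (P : LOCC e d) (ρ : Op d) :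
    (LOCC.comp Q P).apply ρ = Q.apply (P.apply ρ) := by
  induction P with
  | leaf => rfl
  | round j n m K complete isometry next ih =>
    simp only [LOCC.comp, LOCC.apply, ih, LOCC.apply_sum]

theorem Reaches.trans {ψ φ χ : Ket qubits} (h₁ : Reaches ψ φ) (h₂ : Reaches φ χ) :
    Reaches ψ χ := by
  obtain ⟨P, hP⟩ := h₁
  obtain ⟨Q, hQ⟩ := h₂
  exact ⟨LOCC.comp Q P, by rw [LOCC.apply_comp, hP, hQ]⟩

/-- One round of measurement by party `j`, all of whose outcomes lead to the same state. -/
theorem reaches_of_measurement {ψ φ : Ket qubits} (j : Fin 3) (n : ℕ)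
    (K : Fin n → Fin 3 → Matrix (Fin 2) (Fin 2) ℂ) (complete : ∑ k, (K k j)ᴴ * K k j = 1)
    (isometry : ∀ k i, i ≠ j → (K k i)ᴴ * K k i = 1) (c : Fin n → ℂ) (hc : ∑ k, ‖c k‖ ^ 2 = 1)
    (h : ∀ k, tensorOp (d := qubits) (e := qubits) (K k) *ᵥ ψ = c k • φ) : Reaches ψ φ := by
  refine ⟨.round j n (fun _ => qubits) K complete isometry fun _ => .leaf, ?_⟩
  simp only [LOCC.apply, mul_proj_mul_conjTranspose]
  have : ∀ k, proj (tensorOp (d := qubits) (e := qubits) (K k) *ᵥ ψ)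
      = ((‖c k‖ ^ 2 : ℝ) : ℂ) • proj φ := by
    intro k
    rw [h, proj, proj, star_smul, Matrix.smul_vecMulVec, Matrix.vecMulVec_smul, smul_smul]
    congr 1
    rw [Complex.star_def, Complex.mul_conj, Complex.normSq_eq_norm_sq]
  rw [Finset.sum_congr rfl fun k _ => this k, ← Finset.sum_smul, ← Complex.ofReal_sum, hc]
  simp

theorem LUEquiv.reaches {ψ φ : Ket qubits} (h : LUEquiv ψ φ) : Reaches ψ φ := by
  obtain ⟨U, rfl⟩ := h
  have hU : ∀ i, (U i : Matrix (Fin 2) (Fin 2) ℂ)ᴴ * (U i : Matrix (Fin 2) (Fin 2) ℂ) = 1 :=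
    fun i => Unitary.coe_star_mul_self (U i)
  exact reaches_of_measurement 0 1 (fun _ i => U i) (by simp [hU]) (fun _ i _ => hU i)
    (fun _ => 1) (by simp) (fun _ => by simp)

open scoped ComplexOrder in
theorem eq_smul_of_sum_proj {d : Fin 3 → ℕ} {ι : Type*} [Fintype ι] {x : ι → Ket d} {φ : Ket d}
    (hφ : φ ≠ 0) (h : ∑ k, proj (x k) = proj φ) (k : ι) : ∃ c : ℂ, x k = c • φ := by
  have key : ∀ v : Ket d, star φ ⬝ᵥ v = 0 → star (x k) ⬝ᵥ v = 0 := by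
    intro v hv
    have e : ∀ y : Ket d, star v ⬝ᵥ (proj y *ᵥ v) = ((‖star y ⬝ᵥ v‖ ^ 2 : ℝ) : ℂ) := by
      intro y
      rw [proj, Matrix.vecMulVec_mulVec, dotProduct_smul, ← Complex.normSq_eq_norm_sq,
        ← Complex.mul_conj]
      simp only [MulOpposite.smul_eq_mul_unop, MulOpposite.unop_op]
      rw [mul_comm, ← Complex.star_def, Matrix.star_dotProduct, star_star]
    have h1 := congrArg (fun M => star v ⬝ᵥ (M *ᵥ v)) h
    simp only [Matrix.sum_mulVec, dotProduct_sum, e, hv] at h1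
    rw [← Complex.ofReal_sum, Complex.ofReal_inj] at h1
    have h2 := (Finset.sum_eq_zero_iff_of_nonneg (fun i _ => by positivity)).mp
      (h1.trans (by simp)) k (Finset.mem_univ k)
    simpa using h2
  have h0 : star φ ⬝ᵥ φ ≠ 0 := fun h0 => hφ (dotProduct_star_self_eq_zero.mp h0)
  let c := star φ ⬝ᵥ x k / (star φ ⬝ᵥ φ)
  have h1 : star φ ⬝ᵥ (x k - c • φ) = 0 := by
    simp only [dotProduct_sub, dotProduct_smul, c, smul_eq_mul]
    field_simp
    simp
  have h2 := key _ h1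
  have h3 : star (x k - c • φ) ⬝ᵥ (x k - c • φ) = 0 := by
    rw [star_sub, sub_dotProduct, h2, star_smul, smul_dotProduct, h1]
    simp
  exact ⟨c, sub_eq_zero.mp (dotProduct_star_self_eq_zero.mp h3)⟩

/-- A deterministic conversion between entangled states is implemented by Kraus operators each of
which converts the states; branches of probability zero do not contribute. -/
theorem Reaches.exists_kraus {ψ φ : Ket qubits} (hψ : ∀ i, ¬ IsProductAcross ψ i)
    (hφ : ∀ i, ¬ IsProductAcross φ i) (h : Reaches ψ φ) :
    ∃ (ι : Type) (_ : Fintype ι) (K : ι → Fin 3 → Matrix (Fin 2) (Fin 2) ℂ) (c : ι → ℂ),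
      ∑ k, tensorOp (d := qubits) (e := qubits) (fun i => (K k i)ᴴ * K k i) = 1 ∧
      ∀ k, tensorOp (d := qubits) (e := qubits) (K k) *ᵥ ψ = c k • φ ∧ c k ≠ 0 ∧
        ∀ i, IsUnit (K k i).det := by
  obtain ⟨P, hP⟩ := h
  obtain ⟨ι, _, K, h1, h2, h3⟩ := P.exists_kraus
  have hφ0 : φ ≠ 0 := by
    rintro rfl
    exact hφ 0 ⟨0, 0, fun a => by simp⟩
  have hc := eq_smul_of_sum_proj (x := fun k => tensorOp (d := qubits) (e := qubits) (K k) *ᵥ ψ)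
    hφ0 (by rw [← hP, h2]; simp only [mul_proj_mul_conjTranspose])
  choose c hc using hc
  have hdet : ∀ k, c k ≠ 0 → ∀ i, IsUnit (Matrix.det (n := Fin 2) (K k i)) := by
    intro k hk i
    rw [isUnit_iff_ne_zero]
    intro h0
    apply hφ i
    have := (isProductAcross_of_det_eq_zero (K k) ψ i h0).smul (c k)⁻¹
    rwa [hc, smul_smul, inv_mul_cancel₀ hk, one_smul] at this
  have hψ0 : ψ ≠ 0 := by
    rintro rfl
    exact hψ 0 ⟨0, 0, fun a => by simp⟩
  have h4 : ∀ k, c k = 0 → tensorOp (d := qubits) (e := qubits) (K k) = 0 := by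
    have := h3 ψ hψ (fun _ => 1) (by rwa [tensorOp_one, Matrix.one_mulVec]) (fun k => by
      rw [tensorOp_one, Matrix.one_mulVec]
      by_cases hk : c k = 0
      · left
        rw [hc k, hk, zero_smul]
      · right
        intro i
        exact ⟨(show Matrix (Fin 2) (Fin 2) ℂ from K k i)⁻¹, by
          rw [mul_one]
          exact Matrix.nonsing_inv_mul (n := Fin 2) _ (hdet k hk i)⟩)
    intro k hk
    have := this k
    rw [tensorOp_one, Matrix.one_mulVec, hc k, hk, zero_smul, Matrix.mul_one] at this
    simpa using this
  classical
  refine ⟨{k // c k ≠ 0}, inferInstance, fun k => K k, fun k => c k, ?_, fun k =>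
    ⟨hc k, k.2, hdet k k.2⟩⟩
  have h5 : ∀ k, tensorOp (d := qubits) (e := qubits) (fun i => (K k i)ᴴ * K k i)
      = (tensorOp (K k))ᴴ * tensorOp (K k) := fun k => by
    rw [tensorOp_conjTranspose, tensorOp_mul_tensorOp]
  simp only [h5]
  rw [← h1]
  refine Fintype.sum_of_injective Subtype.val Subtype.val_injective _ _ (fun k hk => ?_)
    fun _ => rfl
  have hk0 : c k = 0 := by
    by_contra h0
    exact hk ⟨⟨k, h0⟩, rfl⟩
  rw [h4 k hk0, Matrix.mul_zero]

/-! ### Vectors in the GHZ class -/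

/-- The vector `α |000⟩ + β |111⟩`. -/
def ghzPair (α β : ℂ) : Ket qubits := Pi.single (fun _ => 0) α + Pi.single (fun _ => 1) β

/-- The vector `(g_x^1 ⊗ g_x^2 ⊗ g_x^3) (α |000⟩ + β |111⟩)`. -/
noncomputable def gVec (g : Fin 3 → ℝ) (α β : ℂ) : Ket qubits :=
  tensorOp (d := qubits) (e := qubits) (fun i => gMatrix (g i)) *ᵥ ghzPair α β

theorem tensorOp_mulVec_ghzPair (M : Fin 3 → Matrix (Fin 2) (Fin 2) ℂ) (α β : ℂ)
    (a : Idx qubits) :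
    (tensorOp (d := qubits) (e := qubits) M *ᵥ ghzPair α β) a
      = (∏ i, M i (a i) 0) * α + (∏ i, M i (a i) 1) * β := by
  rw [ghzPair, Matrix.mulVec_add, Matrix.mulVec_single, Matrix.mulVec_single]
  simp [tensorOp, mul_comm]

theorem ghzPair_apply_zero (α β : ℂ) : ghzPair α β (fun _ => 0) = α := by
  simp [ghzPair, funext_iff]

theorem ghzPair_apply_one (α β : ℂ) : ghzPair α β (fun _ => 1) = β := by
  simp [ghzPair, funext_iff]

theorem ghzPair_apply_of_ne {a : Idx qubits} (h0 : a ≠ fun _ => 0) (h1 : a ≠ fun _ => 1)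
    (α β : ℂ) : ghzPair α β a = 0 := by
  simp [ghzPair, h0, h1]

theorem smul_ghzPair (c α β : ℂ) : c • ghzPair α β = ghzPair (c * α) (c * β) := by
  simp [ghzPair, smul_add, ← Pi.single_smul]

theorem smul_gVec (c : ℂ) (g : Fin 3 → ℝ) (α β : ℂ) :
    c • gVec g α β = gVec g (c * α) (c * β) := by
  rw [gVec, gVec, ← smul_ghzPair, Matrix.mulVec_smul]

theorem tensorOp_mulVec_mulVec (A B : Fin 3 → Matrix (Fin 2) (Fin 2) ℂ) (v : Ket qubits) :
    tensorOp (d := qubits) (e := qubits) A *ᵥ (tensorOp (d := qubits) (e := qubits) B *ᵥ v)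
      = tensorOp (d := qubits) (e := qubits) (fun i => A i * B i) *ᵥ v := by
  rw [Matrix.mulVec_mulVec, tensorOp_mul]

/-- Diagonal matrices act on the coefficients of `α |000⟩ + β |111⟩`. -/
theorem tensorOp_mul_diagonal_mulVec_ghzPair (M : Fin 3 → Matrix (Fin 2) (Fin 2) ℂ)
    (d e : Fin 3 → ℂ) (α β : ℂ) :
    tensorOp (d := qubits) (e := qubits) (fun i => M i * Matrix.diagonal ![d i, e i]) *ᵥ
        ghzPair α β
      = tensorOp (d := qubits) (e := qubits) M *ᵥ ghzPair ((∏ i, d i) * α) ((∏ i, e i) * β) := by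
  ext a
  rw [tensorOp_mulVec_ghzPair, tensorOp_mulVec_ghzPair]
  simp only [Matrix.mul_diagonal, Matrix.cons_val_zero, Matrix.cons_val_one,
    Matrix.cons_val_fin_one, Finset.prod_mul_distrib, mul_assoc]

theorem ghzVector_eq (g : Fin 3 → ℝ) (z : ℂ) :
    ghzVector g z = gVec g ((1 / √2 : ℝ) * z) ((1 / √2 : ℝ) * (1 / z)) := by
  have h : ghz = ghzPair (1 / √2 : ℝ) (1 / √2 : ℝ) := by
    ext a
    by_cases h0 : a = fun _ => 0
    · subst h0
      rw [ghzPair_apply_zero]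
      simp [ghz]
    · by_cases h1 : a = fun _ => 1
      · subst h1
        rw [ghzPair_apply_one]
        simp [ghz]
      · rw [ghzPair_apply_of_ne h0 h1, ghz, if_neg, if_neg]
        · exact fun h => h1 (funext h)
        · exact fun h => h0 (funext h)
  have hp : (fun i : Fin 3 => if i = 0 then pMatrix z else 1)
      = fun i : Fin 3 => 1 * Matrix.diagonal
          ![if i = 0 then z else 1, if i = 0 then 1 / z else 1] := by
    ext i a b
    rw [one_mul]
    split_ifs <;> fin_cases a <;> fin_cases b <;> simp [pMatrix]
  rw [ghzVector, h, gVec, hp, tensorOp_mul_diagonal_mulVec_ghzPair, tensorOp_one,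
    Matrix.one_mulVec, Fin.prod_univ_three, Fin.prod_univ_three]
  simp [mul_comm]

theorem gMatrix_conjTranspose_mul {x : ℝ} (hx : |x| < 1 / 2) :
    (gMatrix x)ᴴ * gMatrix x = !![1 / 2, (x : ℂ); (x : ℂ), 1 / 2] := by
  rw [gMatrix_spec x hx.le]
  ext i j
  fin_cases i <;> fin_cases j <;> simp

theorem isUnit_det_gMatrix {x : ℝ} (hx : |x| < 1 / 2) : IsUnit (gMatrix x).det := by
  obtain ⟨h1, h2⟩ := abs_lt.mp hx
  have e1 := Real.sqrt_pos.mpr (show 0 < 1 / 2 + x by linarith)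
  have e2 := Real.sqrt_pos.mpr (show 0 < 1 / 2 - x by linarith)
  have : (gMatrix x).det = ((√(1 / 2 + x) * √(1 / 2 - x) : ℝ) : ℂ) := by
    rw [gMatrix, Matrix.det_fin_two_of]
    push_cast
    ring
  rw [this, isUnit_iff_ne_zero]
  exact_mod_cast (mul_pos e1 e2).ne'

/-- The Pauli matrix `σ_x`. -/
def pauliX : Matrix (Fin 2) (Fin 2) ℂ := !![0, 1; 1, 0]

theorem pauliX_mul_self : pauliX * pauliX = 1 := by
  ext i j
  fin_cases i <;> fin_cases j <;> simp [pauliX]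

theorem pauliX_conjTranspose : pauliXᴴ = pauliX := by
  ext i j
  fin_cases i <;> fin_cases j <;> simp [pauliX]

theorem pauliX_mem_unitaryGroup : pauliX ∈ Matrix.unitaryGroup (Fin 2) ℂ := by
  rw [Matrix.mem_unitaryGroup_iff, Matrix.star_eq_conjTranspose, pauliX_conjTranspose,
    pauliX_mul_self]

theorem pauliX_mul_gMatrix (x : ℝ) : pauliX * gMatrix x = gMatrix x * pauliX := by
  ext i j
  fin_cases i <;> fin_cases j <;> simp [pauliX, gMatrix, Matrix.mul_apply]

theorem pauliX_mulVec_gVec (g : Fin 3 → ℝ) (α β : ℂ) :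
    tensorOp (d := qubits) (e := qubits) (fun _ => pauliX) *ᵥ gVec g α β = gVec g β α := by
  rw [gVec, gVec, tensorOp_mulVec_mulVec]
  ext a
  rw [tensorOp_mulVec_ghzPair, tensorOp_mulVec_ghzPair, add_comm]
  have h0 : ∀ i x, (pauliX * gMatrix (g i)) x 0 = gMatrix (g i) x 1 := fun i x => by
    rw [pauliX_mul_gMatrix]; simp [Matrix.mul_apply, pauliX]
  have h1 : ∀ i x, (pauliX * gMatrix (g i)) x 1 = gMatrix (g i) x 0 := fun i x => by
    rw [pauliX_mul_gMatrix]; simp [Matrix.mul_apply, pauliX]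
  simp only [h0, h1]

theorem luEquiv_gVec_swap (g : Fin 3 → ℝ) (α β : ℂ) : LUEquiv (gVec g α β) (gVec g β α) :=
  ⟨fun _ => ⟨pauliX, pauliX_mem_unitaryGroup⟩, (pauliX_mulVec_gVec g α β).symm⟩

theorem luEquiv_smul {κ : ℂ} (hκ : ‖κ‖ = 1) (ψ : Ket qubits) : LUEquiv ψ (κ • ψ) := by
  have hu : κ • (1 : Matrix (Fin 2) (Fin 2) ℂ) ∈ Matrix.unitaryGroup (Fin 2) ℂ := by
    rw [Matrix.mem_unitaryGroup_iff, star_smul, star_one, Matrix.smul_mul, one_mul, smul_smul,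
      Complex.star_def, Complex.mul_conj, Complex.normSq_eq_norm_sq, hκ]
    simp
  refine ⟨Function.update 1 0 ⟨κ • 1, hu⟩, ?_⟩
  have : (fun i => ((Function.update 1 0 ⟨κ • 1, hu⟩ : Fin 3 → Matrix.unitaryGroup (Fin 2) ℂ) i :
      Matrix (Fin 2) (Fin 2) ℂ)) = Function.update (fun _ => 1) 0 (κ • 1) := by
    ext1 i
    by_cases hi : i = 0
    · subst hi; simp
    · simp [hi]
  rw [this]
  ext a
  rw [tensorOp_update_mulVec, Fintype.sum_eq_single (a 0)]
  · simp
  · intro x hx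
    simp [Matrix.one_apply_ne hx.symm]

/-! ### Norm and entanglement of vectors in the GHZ class -/

theorem star_tensorOp_mulVec_dotProduct (M : Fin 3 → Matrix (Fin 2) (Fin 2) ℂ) (v : Ket qubits) :
    star (tensorOp (d := qubits) (e := qubits) M *ᵥ v) ⬝ᵥ
        (tensorOp (d := qubits) (e := qubits) M *ᵥ v)
      = star v ⬝ᵥ (tensorOp (d := qubits) (e := qubits) (fun i => (M i)ᴴ * M i) *ᵥ v) := by
  rw [Matrix.star_mulVec, ← Matrix.dotProduct_mulVec, Matrix.mulVec_mulVec,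
    tensorOp_conjTranspose, tensorOp_mul_tensorOp]

theorem star_dotProduct_self (v : Ket qubits) :
    star v ⬝ᵥ v = ((∑ a, ‖v a‖ ^ 2 : ℝ) : ℂ) := by
  simp [dotProduct, Complex.conj_mul']

theorem sum_norm_sq_gVec {g : Fin 3 → ℝ} (hg : ∀ i, |g i| < 1 / 2) (α β : ℂ) :
    ∑ a, ‖gVec g α β a‖ ^ 2 = (Complex.normSq α + Complex.normSq β) / 8
      + 2 * (g 0 * g 1 * g 2) * ((starRingEnd ℂ) α * β).re := by
  have h := star_tensorOp_mulVec_dotProduct (fun i => gMatrix (g i)) (ghzPair α β)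
  rw [← gVec, star_dotProduct_self] at h
  have h2 : ∀ w : Ket qubits, star (ghzPair α β) ⬝ᵥ w
      = (starRingEnd ℂ) α * w (fun _ => 0) + (starRingEnd ℂ) β * w (fun _ => 1) := by
    intro w
    rw [ghzPair, star_add, add_dotProduct, Pi.star_single, Pi.star_single, single_dotProduct,
      single_dotProduct]
    rfl
  simp only [fun i => gMatrix_conjTranspose_mul (hg i)] at h
  rw [h2, tensorOp_mulVec_ghzPair, tensorOp_mulVec_ghzPair] at h
  simp only [Fin.prod_univ_three, Matrix.of_apply, Matrix.cons_val_zero, Matrix.cons_val_one,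
    Matrix.cons_val_fin_one] at h
  have h3 := congrArg Complex.re h
  rw [Complex.ofReal_re] at h3
  rw [h3]
  simp only [← Complex.ofReal_mul]
  norm_num [Complex.normSq_apply]
  ring

theorem not_isProductAcross_ghzPair {α β : ℂ} (hα : α ≠ 0) (hβ : β ≠ 0) (i : Fin 3) :
    ¬ IsProductAcross (ghzPair α β) i := by
  rintro ⟨χ, ω, h⟩
  have h0 := h fun _ => 0
  have h1 := h fun _ => 1
  have h2 := h (Function.update (fun _ => 0) i 1)
  rw [ghzPair_apply_zero] at h0
  rw [ghzPair_apply_one] at h1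
  rw [ghzPair_apply_of_ne] at h2
  · have e : (fun k : {k : Fin 3 // k ≠ i} =>
        (Function.update (fun _ => 0) i 1 : Idx qubits) k) = fun _ => 0 := by
      ext1 k
      simp [k.2]
    rw [e] at h2
    simp only [Function.update_self] at h2
    rcases mul_eq_zero.mp h2.symm with h2 | h2
    · exact hβ (by rw [h1, h2, zero_mul])
    · exact hα (by rw [h0, h2, mul_zero])
  · intro hc
    have := congrFun hc i
    simp at this
  · intro hc
    obtain ⟨j, hj⟩ := exists_ne i
    have := congrFun hc j
    simp [hj] at this

theorem not_isProductAcross_gVec {g : Fin 3 → ℝ} (hg : ∀ i, |g i| < 1 / 2) {α β : ℂ}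
    (hα : α ≠ 0) (hβ : β ≠ 0) (i : Fin 3) : ¬ IsProductAcross (gVec g α β) i := by
  intro h
  apply not_isProductAcross_ghzPair hα hβ i
  have := h.tensorOp_mulVec fun i => (gMatrix (g i))⁻¹
  rw [gVec, tensorOp_mulVec_mulVec] at this
  simp only [fun i => Matrix.nonsing_inv_mul _ (isUnit_det_gMatrix (hg i)), tensorOp_one,
    Matrix.one_mulVec] at this
  exact this

theorem LUEquiv.isEntangledState {ψ φ : Ket qubits} (h : LUEquiv ψ φ) (hψ : IsEntangledState ψ) :
    IsEntangledState φ := by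
  refine ⟨?_, fun i hi => ?_⟩
  · obtain ⟨U, rfl⟩ := h
    have hU : ∀ i, (U i : Matrix (Fin 2) (Fin 2) ℂ)ᴴ * (U i : Matrix (Fin 2) (Fin 2) ℂ) = 1 :=
      fun i => Unitary.coe_star_mul_self (U i)
    have h := star_tensorOp_mulVec_dotProduct (fun i => (U i : Matrix (Fin 2) (Fin 2) ℂ)) ψ
    simp only [hU, tensorOp_one, Matrix.one_mulVec, star_dotProduct_self] at h
    rw [← hψ.1]
    exact_mod_cast h
  · obtain ⟨V, hV⟩ := luEquiv_equivalence.symm h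
    apply hψ.2 i
    rw [hV]
    exact hi.tensorOp_mulVec _

/-! ### Necessary conditions for conversion -/

/-- The conditions on the coefficients for a conversion of `α |000⟩ + β |111⟩`, with local
deformations of product `c`, into `α' |000⟩ + β' |111⟩`, with local deformations of product `c'`.
The number `r` is the difference of the probabilities of the branches that map the two product terms
to each other in order, and of those that exchange them. -/
def CoeffConvertible (c : ℝ) (α β : ℂ) (c' : ℝ) (α' β' : ℂ) : Prop :=
  ∃ r : ℝ, |r| ≤ 1 ∧
    Complex.normSq α + Complex.normSq β = Complex.normSq α' + Complex.normSq β' ∧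
    c * ((starRingEnd ℂ) α * β).re = c' * ((starRingEnd ℂ) α' * β').re ∧
    c * ((starRingEnd ℂ) α * β).im = r * (c' * ((starRingEnd ℂ) α' * β').im) ∧
    Complex.normSq α - Complex.normSq β = r * (Complex.normSq α' - Complex.normSq β')

/-- In a sum of two product vectors whose coordinates are those of `α' |000⟩ + β' |111⟩`, mixed
products of coordinates vanish. -/
theorem mixed_products_eq_zero {a₀ a₁ A₀ A₁ u₀₀ U₀₀ u₀₁ U₀₁ u₁₁ U₁₁ p q : ℂ} (hp : p ≠ 0)
    (hq : q ≠ 0) (h₀ : a₀ * u₀₀ + A₀ * U₀₀ = p) (h₁ : a₁ * u₀₀ + A₁ * U₀₀ = 0)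
    (h₂ : a₀ * u₀₁ + A₀ * U₀₁ = 0) (h₃ : a₁ * u₀₁ + A₁ * U₀₁ = 0)
    (h₄ : a₁ * u₁₁ + A₁ * U₁₁ = q) : u₀₁ = 0 ∧ U₀₁ = 0 := by
  have hdet : a₀ * A₁ - a₁ * A₀ ≠ 0 := by
    intro hd
    have e₁ : p * A₁ = 0 := by linear_combination u₀₀ * hd - A₁ * h₀ + A₀ * h₁
    have e₂ : p * a₁ = 0 := by linear_combination (-U₀₀) * hd - a₁ * h₀ + a₀ * h₁
    have e₁ := (mul_eq_zero.mp e₁).resolve_left hp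
    have e₂ := (mul_eq_zero.mp e₂).resolve_left hp
    rw [e₁, e₂, zero_mul, zero_mul, add_zero] at h₄
    exact hq h₄.symm
  constructor
  · exact (mul_eq_zero.mp (show (a₀ * A₁ - a₁ * A₀) * u₀₁ = 0 by
      linear_combination A₁ * h₂ - A₀ * h₃)).resolve_left hdet
  · exact (mul_eq_zero.mp (show (a₀ * A₁ - a₁ * A₀) * U₀₁ = 0 by
      linear_combination -a₁ * h₂ + a₀ * h₃)).resolve_left hdet

/-- The decomposition of `α' |000⟩ + β' |111⟩` into two product vectors is unique: a product
operator between such vectors is diagonal on all qubits, or antidiagonal on all qubits. -/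
theorem diagonal_or_antidiagonal {D : Fin 3 → Matrix (Fin 2) (Fin 2) ℂ} {α β α' β' : ℂ}
    (hα' : α' ≠ 0) (hβ' : β' ≠ 0)
    (h : tensorOp (d := qubits) (e := qubits) D *ᵥ ghzPair α β = ghzPair α' β') :
    (∀ i, D i 1 0 = 0 ∧ D i 0 1 = 0) ∨ ∀ i, D i 0 0 = 0 ∧ D i 1 1 = 0 := by
  have H : ∀ x y z : Fin 2, (D 0 x 0 * D 1 y 0 * D 2 z 0) * α + (D 0 x 1 * D 1 y 1 * D 2 z 1) * β
      = ghzPair α' β' ![x, y, z] := by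
    intro x y z
    have := congrFun h ![x, y, z]
    rw [tensorOp_mulVec_ghzPair] at this
    simpa [Fin.prod_univ_three] using this
  have H000 := H 0 0 0
  have H100 := H 1 0 0
  have H010 := H 0 1 0
  have H001 := H 0 0 1
  have H011 := H 0 1 1
  have H101 := H 1 0 1
  have H110 := H 1 1 0
  have H111 := H 1 1 1
  have ez : (![0, 0, 0] : Fin 3 → Fin 2) = fun _ => 0 := by ext i; fin_cases i <;> rfl
  have eo : (![1, 1, 1] : Fin 3 → Fin 2) = fun _ => 1 := by ext i; fin_cases i <;> rfl
  rw [ez, ghzPair_apply_zero] at H000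
  rw [eo, ghzPair_apply_one] at H111
  rw [ghzPair_apply_of_ne (fun h => by simpa using congrFun h 0)
    (fun h => by simpa using congrFun h 1)] at H100
  rw [ghzPair_apply_of_ne (fun h => by simpa using congrFun h 1)
    (fun h => by simpa using congrFun h 0)] at H010
  rw [ghzPair_apply_of_ne (fun h => by simpa using congrFun h 2)
    (fun h => by simpa using congrFun h 0)] at H001
  rw [ghzPair_apply_of_ne (fun h => by simpa using congrFun h 1)
    (fun h => by simpa using congrFun h 0)] at H011
  rw [ghzPair_apply_of_ne (fun h => by simpa using congrFun h 0)
    (fun h => by simpa using congrFun h 1)] at H101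
  rw [ghzPair_apply_of_ne (fun h => by simpa using congrFun h 0)
    (fun h => by simpa using congrFun h 2)] at H110
  rw [Fin.forall_fin_succ, Fin.forall_fin_two, Fin.forall_fin_succ, Fin.forall_fin_two]
  simp only [Fin.succ_zero_eq_one, Fin.succ_one_eq_two]
  clear H h ez eo
  generalize D 0 0 0 = a₀, D 0 1 0 = a₁, D 1 0 0 = b₀, D 1 1 0 = b₁, D 2 0 0 = c₀,
    D 2 1 0 = c₁, D 0 0 1 = A₀, D 0 1 1 = A₁, D 1 0 1 = B₀, D 1 1 1 = B₁,
    D 2 0 1 = C₀, D 2 1 1 = C₁ at *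
  -- For each ordered pair of qubits, with the third one in the role of `a₀, a₁, A₀, A₁`.
  have hbc := mixed_products_eq_zero (a₀ := a₀ * α) (a₁ := a₁ * α) (A₀ := A₀ * β) (A₁ := A₁ * β)
    (u₀₀ := b₀ * c₀) (U₀₀ := B₀ * C₀) (u₀₁ := b₀ * c₁) (U₀₁ := B₀ * C₁)
    (u₁₁ := b₁ * c₁) (U₁₁ := B₁ * C₁) hα' hβ' (by linear_combination H000)
    (by linear_combination H100) (by linear_combination H001)
    (by linear_combination H101) (by linear_combination H111)
  have hcb := mixed_products_eq_zero (a₀ := a₀ * α) (a₁ := a₁ * α) (A₀ := A₀ * β) (A₁ := A₁ * β)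
    (u₀₀ := b₀ * c₀) (U₀₀ := B₀ * C₀) (u₀₁ := b₁ * c₀) (U₀₁ := B₁ * C₀)
    (u₁₁ := b₁ * c₁) (U₁₁ := B₁ * C₁) hα' hβ' (by linear_combination H000)
    (by linear_combination H100) (by linear_combination H010)
    (by linear_combination H110) (by linear_combination H111)
  have hac := mixed_products_eq_zero (a₀ := b₀ * α) (a₁ := b₁ * α) (A₀ := B₀ * β) (A₁ := B₁ * β)
    (u₀₀ := a₀ * c₀) (U₀₀ := A₀ * C₀) (u₀₁ := a₀ * c₁) (U₀₁ := A₀ * C₁)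
    (u₁₁ := a₁ * c₁) (U₁₁ := A₁ * C₁) hα' hβ' (by linear_combination H000)
    (by linear_combination H010) (by linear_combination H001)
    (by linear_combination H011) (by linear_combination H111)
  have hca := mixed_products_eq_zero (a₀ := b₀ * α) (a₁ := b₁ * α) (A₀ := B₀ * β) (A₁ := B₁ * β)
    (u₀₀ := a₀ * c₀) (U₀₀ := A₀ * C₀) (u₀₁ := a₁ * c₀) (U₀₁ := A₁ * C₀)
    (u₁₁ := a₁ * c₁) (U₁₁ := A₁ * C₁) hα' hβ' (by linear_combination H000)
    (by linear_combination H010) (by linear_combination H100)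
    (by linear_combination H110) (by linear_combination H111)
  have hab := mixed_products_eq_zero (a₀ := c₀ * α) (a₁ := c₁ * α) (A₀ := C₀ * β) (A₁ := C₁ * β)
    (u₀₀ := a₀ * b₀) (U₀₀ := A₀ * B₀) (u₀₁ := a₀ * b₁) (U₀₁ := A₀ * B₁)
    (u₁₁ := a₁ * b₁) (U₁₁ := A₁ * B₁) hα' hβ' (by linear_combination H000)
    (by linear_combination H001) (by linear_combination H010)
    (by linear_combination H011) (by linear_combination H111)
  have hba := mixed_products_eq_zero (a₀ := c₀ * α) (a₁ := c₁ * α) (A₀ := C₀ * β) (A₁ := C₁ * β)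
    (u₀₀ := a₀ * b₀) (U₀₀ := A₀ * B₀) (u₀₁ := a₁ * b₀) (U₀₁ := A₁ * B₀)
    (u₁₁ := a₁ * b₁) (U₁₁ := A₁ * B₁) hα' hβ' (by linear_combination H000)
    (by linear_combination H001) (by linear_combination H100)
    (by linear_combination H101) (by linear_combination H111)
  -- The coefficient of `|000⟩` comes from the first product vector or from the second one.
  by_cases hz : a₀ * b₀ * c₀ = 0
  · right
    rw [hz, zero_mul, zero_add] at H000
    have hne : A₀ * B₀ * C₀ ≠ 0 := fun h0 => hα' (by rw [← H000, h0, zero_mul])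
    obtain ⟨⟨hA, hB⟩, hC⟩ := (by simpa [mul_ne_zero_iff] using hne : (A₀ ≠ 0 ∧ B₀ ≠ 0) ∧ C₀ ≠ 0)
    have hA1 : A₁ = 0 := (mul_eq_zero.mp hba.2).resolve_right hB
    have hB1 : B₁ = 0 := (mul_eq_zero.mp hab.2).resolve_left hA
    have hC1 : C₁ = 0 := (mul_eq_zero.mp hac.2).resolve_left hA
    rw [hA1, zero_mul, zero_mul, zero_mul, add_zero] at H111
    have hne : a₁ * b₁ * c₁ ≠ 0 := fun h0 => hβ' (by rw [← H111, h0, zero_mul])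
    obtain ⟨⟨ha, hb⟩, hc⟩ := (by simpa [mul_ne_zero_iff] using hne : (a₁ ≠ 0 ∧ b₁ ≠ 0) ∧ c₁ ≠ 0)
    have ha0 : a₀ = 0 := (mul_eq_zero.mp hab.1).resolve_right hb
    have hb0 : b₀ = 0 := (mul_eq_zero.mp hba.1).resolve_left ha
    have hc0 : c₀ = 0 := (mul_eq_zero.mp hca.1).resolve_left ha
    simp [*]
  · left
    obtain ⟨⟨ha, hb⟩, hc⟩ := (by simpa [mul_ne_zero_iff] using hz : (a₀ ≠ 0 ∧ b₀ ≠ 0) ∧ c₀ ≠ 0)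
    have ha1 : a₁ = 0 := (mul_eq_zero.mp hba.1).resolve_right hb
    have hb1 : b₁ = 0 := (mul_eq_zero.mp hab.1).resolve_left ha
    have hc1 : c₁ = 0 := (mul_eq_zero.mp hac.1).resolve_left ha
    rw [ha1, zero_mul, zero_mul, zero_mul, zero_add] at H111
    have hne : A₁ * B₁ * C₁ ≠ 0 := fun h0 => hβ' (by rw [← H111, h0, zero_mul])
    obtain ⟨⟨hA, hB⟩, hC⟩ := (by simpa [mul_ne_zero_iff] using hne : (A₁ ≠ 0 ∧ B₁ ≠ 0) ∧ C₁ ≠ 0)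
    have hA0 : A₀ = 0 := (mul_eq_zero.mp hab.2).resolve_right hB
    have hB0 : B₀ = 0 := (mul_eq_zero.mp hba.2).resolve_left hA
    have hC0 : C₀ = 0 := (mul_eq_zero.mp hca.2).resolve_left hA
    simp [*]

/-- In a branch of a conversion, the local Gram matrices of the images of the two product terms, and
the coefficients of the target in terms of the scale factors `l`, `m` of these images. The
antidiagonal case has Gram matrices of the same form because `σ_x` commutes with `g_x`. -/
theorem branch_gram {g h : Fin 3 → ℝ} (hh : ∀ i, |h i| < 1 / 2)
    {α β α' β' c : ℂ} (hα' : α' ≠ 0) (hβ' : β' ≠ 0) (hc : c ≠ 0)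
    {K : Fin 3 → Matrix (Fin 2) (Fin 2) ℂ}
    (hK : tensorOp (d := qubits) (e := qubits) K *ᵥ gVec g α β = c • gVec h α' β') :
    ∃ l m : Fin 3 → ℂ,
      (∀ i, (K i * gMatrix (g i))ᴴ * (K i * gMatrix (g i))
        = !![(Complex.normSq (l i) : ℂ) / 2, h i * ((starRingEnd ℂ) (l i) * m i);
            h i * ((starRingEnd ℂ) (m i) * l i), (Complex.normSq (m i) : ℂ) / 2]) ∧
      ((α * ∏ i, l i = c * α' ∧ β * ∏ i, m i = c * β') ∨
        (α * ∏ i, l i = c * β' ∧ β * ∏ i, m i = c * α')) := by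
  let D : Fin 3 → Matrix (Fin 2) (Fin 2) ℂ := fun i => (gMatrix (h i))⁻¹ * (K i * gMatrix (g i))
  have hKD : ∀ i, K i * gMatrix (g i) = gMatrix (h i) * D i := fun i => by
    rw [← Matrix.mul_assoc, Matrix.mul_nonsing_inv _ (isUnit_det_gMatrix (hh i)), Matrix.one_mul]
  have hD : tensorOp (d := qubits) (e := qubits) D *ᵥ ghzPair α β = ghzPair (c * α') (c * β') := by
    rw [gVec, tensorOp_mulVec_mulVec] at hK
    have := congrArg (fun v => tensorOp (d := qubits) (e := qubits)
      (fun i => (gMatrix (h i))⁻¹) *ᵥ v) hK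
    simp only [tensorOp_mulVec_mulVec] at this
    rw [smul_gVec, gVec, tensorOp_mulVec_mulVec] at this
    simpa only [fun i => Matrix.nonsing_inv_mul _ (isUnit_det_gMatrix (hh i)), tensorOp_one,
      Matrix.one_mulVec] using this
  have h0 := congrFun hD fun _ => 0
  have h1 := congrFun hD fun _ => 1
  rw [tensorOp_mulVec_ghzPair, ghzPair_apply_zero] at h0
  rw [tensorOp_mulVec_ghzPair, ghzPair_apply_one] at h1
  have hG : ∀ i, (K i * gMatrix (g i))ᴴ * (K i * gMatrix (g i))
      = (D i)ᴴ * (!![1 / 2, (h i : ℂ); (h i : ℂ), 1 / 2] * D i) := fun i => by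
    rw [hKD, Matrix.conjTranspose_mul, ← gMatrix_conjTranspose_mul (hh i)]
    simp only [Matrix.mul_assoc]
  rcases diagonal_or_antidiagonal (mul_ne_zero hc hα') (mul_ne_zero hc hβ') hD with hd | hd
  · refine ⟨fun i => D i 0 0, fun i => D i 1 1, fun i => ?_, Or.inl ⟨?_, ?_⟩⟩
    · rw [hG]
      obtain ⟨e1, e2⟩ := hd i
      ext x y
      fin_cases x <;> fin_cases y <;>
        simp [Matrix.mul_apply, Matrix.vecMul, dotProduct, Fin.sum_univ_two, e1, e2,
          Complex.normSq_eq_conj_mul_self] <;> ring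
    · simpa [fun i => (hd i).2, mul_comm] using h0
    · simpa [fun i => (hd i).1, mul_comm] using h1
  · refine ⟨fun i => D i 1 0, fun i => D i 0 1, fun i => ?_, Or.inr ⟨?_, ?_⟩⟩
    · rw [hG]
      obtain ⟨e1, e2⟩ := hd i
      ext x y
      fin_cases x <;> fin_cases y <;>
        simp [Matrix.mul_apply, Matrix.vecMul, dotProduct, Fin.sum_univ_two, e1, e2,
          Complex.normSq_eq_conj_mul_self] <;> ring
    · simpa [fun i => (hd i).2, mul_comm] using h1
    · simpa [fun i => (hd i).1, mul_comm] using h0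

open Complex in
/-- A branch of a conversion contributes, up to its probability, the coefficients of the target or
those with the two product terms exchanged. -/
theorem branch_coeff {α β α' β' c L M : ℂ}
    (h : (α * L = c * α' ∧ β * M = c * β') ∨ (α * L = c * β' ∧ β * M = c * α')) :
    ∃ p p' : ℝ, 0 ≤ p ∧ 0 ≤ p' ∧
      normSq α * normSq L = p * normSq α' + p' * normSq β' ∧
      normSq β * normSq M = p * normSq β' + p' * normSq α' ∧
      (((starRingEnd ℂ) α * β) * ((starRingEnd ℂ) L * M)).re
        = (p + p') * ((starRingEnd ℂ) α' * β').re ∧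
      (((starRingEnd ℂ) α * β) * ((starRingEnd ℂ) L * M)).im
        = (p - p') * ((starRingEnd ℂ) α' * β').im := by
  have e : ((starRingEnd ℂ) α * β) * ((starRingEnd ℂ) L * M)
      = (starRingEnd ℂ) (α * L) * (β * M) := by rw [map_mul]; ring
  have e2 : ∀ x y : ℂ, (starRingEnd ℂ) (c * x) * (c * y)
      = (normSq c : ℂ) * ((starRingEnd ℂ) x * y) := fun x y => by
    rw [normSq_eq_conj_mul_self, map_mul]; ring
  rw [← normSq_mul, ← normSq_mul, e]
  rcases h with ⟨h1, h2⟩ | ⟨h1, h2⟩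
  · refine ⟨normSq c, 0, normSq_nonneg c, le_rfl, ?_, ?_, ?_, ?_⟩
    · rw [h1, normSq_mul]; ring
    · rw [h2, normSq_mul]; ring
    · rw [h1, h2, e2, re_ofReal_mul, add_zero]
    · rw [h1, h2, e2, im_ofReal_mul, sub_zero]
  · refine ⟨0, normSq c, le_rfl, normSq_nonneg c, ?_, ?_, ?_, ?_⟩
    · rw [h1, normSq_mul]; ring
    · rw [h2, normSq_mul]; ring
    · rw [h1, h2, e2, re_ofReal_mul, zero_add]
      simp [mul_comm]
    · rw [h1, h2, e2, im_ofReal_mul]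
      simp only [mul_im, conj_re, conj_im]
      ring

open Complex in
/-- In a deterministic conversion between vectors in the GHZ class, no local parameter decreases,
and the coefficients satisfy `CoeffConvertible`. -/
theorem Reaches.necessary {g h : Fin 3 → ℝ} (hg : ∀ i, |g i| < 1 / 2)
    (hh : ∀ i, 0 ≤ h i ∧ h i < 1 / 2) {α β α' β' : ℂ} (hα : α ≠ 0) (hβ : β ≠ 0) (hα' : α' ≠ 0)
    (hβ' : β' ≠ 0) (hn : ∑ a, ‖gVec g α β a‖ ^ 2 = 1) (hn' : ∑ a, ‖gVec h α' β' a‖ ^ 2 = 1)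
    (H : Reaches (gVec g α β) (gVec h α' β')) :
    (∀ i, g i ≤ h i) ∧
      CoeffConvertible (g 0 * g 1 * g 2) α β (h 0 * h 1 * h 2) α' β' := by
  have hh' : ∀ i, |h i| < 1 / 2 := fun i => abs_lt.mpr ⟨by linarith [(hh i).1], (hh i).2⟩
  obtain ⟨ι, _, K, c, hK, hc⟩ := H.exists_kraus (not_isProductAcross_gVec hg hα hβ)
    (not_isProductAcross_gVec hh' hα' hβ')
  have hb := fun k => branch_gram (g := g) hh' hα' hβ' (hc k).2.1 (hc k).1
  choose l m hG hcase using hb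
  have hS : ∀ a b : Idx qubits,
      ∑ k, ∏ i, (!![(normSq (l k i) : ℂ) / 2, h i * ((starRingEnd ℂ) (l k i) * m k i);
          h i * ((starRingEnd ℂ) (m k i) * l k i), (normSq (m k i) : ℂ) / 2] :
          Matrix (Fin 2) (Fin 2) ℂ) (a i) (b i)
        = ∏ i, (!![1 / 2, (g i : ℂ); (g i : ℂ), 1 / 2] : Matrix (Fin 2) (Fin 2) ℂ)
            (a i) (b i) := by
    intro a b
    have e := congrArg (fun T => (tensorOp (d := qubits) (e := qubits)
      (fun i => (gMatrix (g i))ᴴ) * T *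
        tensorOp (d := qubits) (e := qubits) (fun i => gMatrix (g i))) a b) hK
    simp only [Matrix.mul_sum, Matrix.sum_mul, tensorOp_mul, Matrix.mul_one] at e
    simp only [Matrix.sum_apply, tensorOp_apply,
      fun i => gMatrix_conjTranspose_mul (hg i)] at e
    rw [← e]
    refine Finset.sum_congr rfl fun k _ => Finset.prod_congr rfl fun i _ => ?_
    rw [← hG, Matrix.conjTranspose_mul]
    simp only [Matrix.mul_assoc]
  have hl : ∑ k, normSq (∏ i, l k i) = 1 := by
    have := hS (fun _ => 0) (fun _ => 0)
    simp only [Fin.prod_univ_three, Matrix.of_apply, Matrix.cons_val_zero, normSq_mul] at this ⊢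
    apply_fun fun x => 8 * x at this
    rw [Finset.mul_sum] at this
    rw [← Complex.ofReal_inj]
    push_cast
    convert this using 1
    · exact Finset.sum_congr rfl fun k _ => by ring
    · norm_num
  have hm : ∑ k, normSq (∏ i, m k i) = 1 := by
    have := hS (fun _ => 1) (fun _ => 1)
    simp only [Fin.prod_univ_three, Matrix.of_apply, Matrix.cons_val_one, Matrix.cons_val_fin_one,
      normSq_mul] at this ⊢
    apply_fun fun x => 8 * x at this
    rw [Finset.mul_sum] at this
    rw [← Complex.ofReal_inj]
    push_cast
    convert this using 1
    · exact Finset.sum_congr rfl fun k _ => by ring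
    · norm_num
  have hlm : (((h 0 * h 1 * h 2 : ℝ) : ℂ)) * ∑ k, ((starRingEnd ℂ) (∏ i, l k i) * ∏ i, m k i)
      = ((g 0 * g 1 * g 2 : ℝ) : ℂ) := by
    have := hS (fun _ => 0) (fun _ => 1)
    simp only [Fin.prod_univ_three, Matrix.of_apply, Matrix.cons_val_zero, Matrix.cons_val_one,
      Matrix.cons_val_fin_one, map_mul] at this ⊢
    push_cast
    rw [← this, Finset.mul_sum]
    exact Finset.sum_congr rfl fun k _ => by ring
  constructor
  · intro i
    let R : ι → ℝ := fun k => ∏ j ∈ Finset.univ.erase i, (normSq (l k j) / 2)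
    have hR : ∀ k, 0 ≤ R k := fun k => Finset.prod_nonneg fun j _ => by
      have := normSq_nonneg (l k j)
      positivity
    have hcard : (Finset.univ.erase i).card = 2 := by
      rw [Finset.card_erase_of_mem (Finset.mem_univ i)]; rfl
    have hprod : ∀ (a b : Idx qubits), (∀ j, j ≠ i → a j = 0) → (∀ j, j ≠ i → b j = 0) →
        ∑ k, (!![(normSq (l k i) : ℂ) / 2, h i * ((starRingEnd ℂ) (l k i) * m k i);
          h i * ((starRingEnd ℂ) (m k i) * l k i), (normSq (m k i) : ℂ) / 2] :
          Matrix (Fin 2) (Fin 2) ℂ) (a i) (b i) * (R k : ℂ)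
        = (!![1 / 2, (g i : ℂ); (g i : ℂ), 1 / 2] : Matrix (Fin 2) (Fin 2) ℂ)
            (a i) (b i) * (1 / 4) := by
      intro a b ha hb
      have := hS a b
      simp only [← Finset.mul_prod_erase _ _ (Finset.mem_univ i)] at this
      rw [Finset.prod_congr rfl (g := fun _ => (1 / 2 : ℂ)) (fun j hj => by
        rw [ha j (Finset.ne_of_mem_erase hj), hb j (Finset.ne_of_mem_erase hj)]; rfl)] at this
      rw [Finset.prod_const, hcard] at this
      norm_num at this ⊢
      rw [← this]
      refine Finset.sum_congr rfl fun k _ => ?_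
      congr 1
      simp only [R, ofReal_prod]
      refine Finset.prod_congr rfl fun j hj => ?_
      rw [ha j (Finset.ne_of_mem_erase hj), hb j (Finset.ne_of_mem_erase hj)]
      simp
    have e1 := hprod (fun _ => 0) (fun _ => 0) (fun _ _ => rfl) fun _ _ => rfl
    have e2 := hprod (Function.update (fun _ => 0) i 1) (Function.update (fun _ => 0) i 1)
      (fun j hj => by simp [hj]) fun j hj => by simp [hj]
    have e3 := hprod (fun _ => 0) (Function.update (fun _ => 0) i 1)
      (fun _ _ => rfl) fun j hj => by simp [hj]
    simp only [Function.update_self, Matrix.of_apply, Matrix.cons_val_zero, Matrix.cons_val_one,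
      Matrix.cons_val_fin_one] at e1 e2 e3
    have e1 : ∑ k, normSq (l k i) / 2 * R k = 1 / 2 * (1 / 4) := by
      rw [← Complex.ofReal_inj]; push_cast; exact e1
    have e2 : ∑ k, normSq (m k i) / 2 * R k = 1 / 2 * (1 / 4) := by
      rw [← Complex.ofReal_inj]; push_cast; exact e2
    have e3 := congrArg Complex.re e3
    have e3 : ∑ k, h i * ((starRingEnd ℂ) (l k i) * m k i).re * R k = g i * (1 / 4) := by
      rw [re_sum] at e3
      have e4 : ((g i : ℂ) * (1 / 4)).re = g i * (1 / 4) := by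
        rw [re_ofReal_mul]; norm_num
      rw [e4] at e3
      rw [← e3]
      refine Finset.sum_congr rfl fun k _ => ?_
      rw [re_mul_ofReal, re_ofReal_mul]
    -- The overlap on qubit `i` is bounded by the arithmetic mean of the two squared norms.
    have e5 : ∑ k, h i * ((starRingEnd ℂ) (l k i) * m k i).re * R k
        ≤ ∑ k, h i * (normSq (l k i) / 2 * R k + normSq (m k i) / 2 * R k) := by
      refine Finset.sum_le_sum fun k _ => ?_
      rw [mul_assoc]
      refine mul_le_mul_of_nonneg_left ?_ (hh i).1
      rw [← add_mul]
      refine mul_le_mul_of_nonneg_right ?_ (hR k)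
      simp only [mul_re, conj_re, conj_im, normSq_apply]
      nlinarith [sq_nonneg ((l k i).re - (m k i).re), sq_nonneg ((l k i).im - (m k i).im)]
    rw [← Finset.mul_sum, Finset.sum_add_distrib, e1, e2, e3] at e5
    linarith
  · have hp := fun k => branch_coeff (hcase k)
    choose p p' hp0 hp0' hp1 hp2 hp3 hp4 using hp
    have f1 : normSq α = (∑ k, p k) * normSq α' + (∑ k, p' k) * normSq β' := by
      rw [← mul_one (normSq α), ← hl, Finset.mul_sum, Finset.sum_congr rfl fun k _ => hp1 k,
        Finset.sum_add_distrib, ← Finset.sum_mul, ← Finset.sum_mul]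
    have f2 : normSq β = (∑ k, p k) * normSq β' + (∑ k, p' k) * normSq α' := by
      rw [← mul_one (normSq β), ← hm, Finset.mul_sum, Finset.sum_congr rfl fun k _ => hp2 k,
        Finset.sum_add_distrib, ← Finset.sum_mul, ← Finset.sum_mul]
    have f0 : ((g 0 * g 1 * g 2 : ℝ) : ℂ) * ((starRingEnd ℂ) α * β)
        = ((h 0 * h 1 * h 2 : ℝ) : ℂ) * ∑ k, ((starRingEnd ℂ) α * β) *
            ((starRingEnd ℂ) (∏ i, l k i) * ∏ i, m k i) := by
      rw [← Finset.mul_sum, ← hlm]; ring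
    have f3 := congrArg re f0
    have f4 := congrArg im f0
    rw [re_ofReal_mul, re_ofReal_mul, re_sum, Finset.sum_congr rfl fun k _ => hp3 k,
      ← Finset.sum_mul, Finset.sum_add_distrib] at f3
    rw [im_ofReal_mul, im_ofReal_mul, im_sum, Finset.sum_congr rfl fun k _ => hp4 k,
      ← Finset.sum_mul, Finset.sum_sub_distrib] at f4
    have hP := Finset.sum_nonneg fun k (_ : k ∈ Finset.univ) => hp0 k
    have hP' := Finset.sum_nonneg fun k (_ : k ∈ Finset.univ) => hp0' k
    generalize ∑ k, p k = P at *
    generalize ∑ k, p' k = P' at *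
    -- The total probability is one, because both vectors are normalised.
    have hPP : P + P' = 1 := by
      rw [sum_norm_sq_gVec hg] at hn
      rw [sum_norm_sq_gVec hh'] at hn'
      linear_combination hn - (P + P') * hn' - f1 / 8 - f2 / 8 - 2 * f3
    refine ⟨P - P', abs_le.mpr ⟨by linarith, by linarith⟩, ?_, ?_, ?_, ?_⟩
    · linear_combination f1 + f2 + (normSq α' + normSq β') * hPP
    · linear_combination f3 + h 0 * h 1 * h 2 * ((starRingEnd ℂ) α' * β').re * hPP
    · linear_combination f4
    · linear_combination f1 - f2

section

open Complex

/-! ### Coefficients up to local unitaries -/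

theorem normSq_add_sq (α β : ℂ) :
    (normSq α + normSq β) ^ 2 = (normSq α - normSq β) ^ 2
      + 4 * ((starRingEnd ℂ) α * β).re ^ 2 + 4 * ((starRingEnd ℂ) α * β).im ^ 2 := by
  simp only [normSq_apply, mul_re, mul_im, conj_re, conj_im]
  ring

theorem normSq_add_pos {α : ℂ} (hα : α ≠ 0) (β : ℂ) : 0 < normSq α + normSq β :=
  add_pos_of_pos_of_nonneg (normSq_pos.mpr hα) (normSq_nonneg β)

theorem luEquiv_gVec_of_eq (g : Fin 3 → ℝ) {α β α' β' : ℂ} (hα : α ≠ 0)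
    (h : normSq α = normSq α') (hw : (starRingEnd ℂ) α * β = (starRingEnd ℂ) α' * β') :
    LUEquiv (gVec g α β) (gVec g α' β') := by
  have hα' : α' ≠ 0 := by rwa [← normSq_pos, ← h, normSq_pos]
  have hc : (starRingEnd ℂ) α' ≠ 0 := by simpa using hα'
  have h2 : (starRingEnd ℂ) α * α = (starRingEnd ℂ) α' * α' := by
    rw [← normSq_eq_conj_mul_self, ← normSq_eq_conj_mul_self, h]
  have hκ : ‖α' / α‖ = 1 := by
    rw [← sq_eq_sq₀ (norm_nonneg _) zero_le_one, ← normSq_eq_norm_sq, normSq_div, h,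
      div_self (normSq_pos.mpr hα').ne', one_pow]
  have e1 : α' / α * α = α' := by field_simp
  have e2 : α' / α * β = β' := by
    rw [div_mul_eq_mul_div, div_eq_iff hα]
    apply mul_left_cancel₀ hc
    linear_combination α * hw - β * h2
  have := luEquiv_smul hκ (gVec g α β)
  rwa [smul_gVec, e1, e2] at this

/-- The coefficients enter the local unitary class of a vector in the GHZ class only through
`|α|² + |β|²`, `Re (ᾱ β)`, `|α|² - |β|²` and `Im (ᾱ β)`, the last two up to a common sign. -/
theorem luEquiv_gVec_of_invariants (g : Fin 3 → ℝ) {α β α' β' : ℂ} (hα : α ≠ 0) (hβ : β ≠ 0)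
    (hS : normSq α + normSq β = normSq α' + normSq β')
    (hX : ((starRingEnd ℂ) α * β).re = ((starRingEnd ℂ) α' * β').re)
    {ε : ℝ} (hε : ε = 1 ∨ ε = -1)
    (hY : ((starRingEnd ℂ) α * β).im = ε * ((starRingEnd ℂ) α' * β').im)
    (hU : normSq α - normSq β = ε * (normSq α' - normSq β')) :
    LUEquiv (gVec g α β) (gVec g α' β') := by
  rcases hε with rfl | rfl
  · exact luEquiv_gVec_of_eq g hα (by linarith) (Complex.ext hX (by linarith))
  · refine luEquiv_equivalence.trans (luEquiv_gVec_swap g α β)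
      (luEquiv_gVec_of_eq g hβ (by linarith) (Complex.ext ?_ ?_))
    · rw [← hX]
      simp only [mul_re, conj_re, conj_im]
      ring
    · simp only [mul_im, conj_re, conj_im] at hY ⊢
      linarith

/-- Proportional vectors that agree up to norm, with nonzero factors, have factors equal up to
sign. -/
theorem sign_of_norm_eq {u y u₁ y₁ u₂ y₂ r₁ r₂ : ℝ} (h0 : u ≠ 0 ∨ y ≠ 0) (hu₁ : u = r₁ * u₁)
    (hy₁ : y = r₁ * y₁) (hu₂ : u = r₂ * u₂) (hy₂ : y = r₂ * y₂)
    (h : u₁ ^ 2 + 4 * y₁ ^ 2 = u₂ ^ 2 + 4 * y₂ ^ 2) :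
    ∃ ε : ℝ, (ε = 1 ∨ ε = -1) ∧ u₁ = ε * u₂ ∧ y₁ = ε * y₂ := by
  have hr₁ : r₁ ≠ 0 := by
    rintro rfl
    rcases h0 with h0 | h0
    · exact h0 (by rw [hu₁, zero_mul])
    · exact h0 (by rw [hy₁, zero_mul])
  have hpos : u ^ 2 + 4 * y ^ 2 ≠ 0 := by
    rcases h0 with h0 | h0 <;> positivity
  have h1 : u ^ 2 + 4 * y ^ 2 = r₁ ^ 2 * (u₁ ^ 2 + 4 * y₁ ^ 2) := by rw [hu₁, hy₁]; ring
  have h2 : u ^ 2 + 4 * y ^ 2 = r₂ ^ 2 * (u₂ ^ 2 + 4 * y₂ ^ 2) := by rw [hu₂, hy₂]; ring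
  have hne : u₁ ^ 2 + 4 * y₁ ^ 2 ≠ 0 := by
    intro h0
    exact hpos (by rw [h1, h0, mul_zero])
  have hsq : r₁ ^ 2 = r₂ ^ 2 := by
    apply mul_right_cancel₀ hne
    rw [← h1, h2, h]
  rcases sq_eq_sq_iff_eq_or_eq_neg.mp hsq with hr | hr
  · refine ⟨1, Or.inl rfl, ?_, ?_⟩ <;> apply mul_left_cancel₀ hr₁
    · rw [← hu₁, hu₂, hr]; ring
    · rw [← hy₁, hy₂, hr]; ring
  · refine ⟨-1, Or.inr rfl, ?_, ?_⟩ <;> apply mul_left_cancel₀ hr₁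
    · rw [← hu₁, hu₂, hr]; ring
    · rw [← hy₁, hy₂, hr]; ring

/-- The target of a conversion with given local parameters is unique up to local unitaries. -/
theorem luEquiv_of_common_source {c c' : ℝ} (hc : c ≠ 0) (hc' : c' ≠ 0) {α β α₁ β₁ α₂ β₂ : ℂ}
    (hα₁ : α₁ ≠ 0) (hβ₁ : β₁ ≠ 0)
    (h0 : normSq α - normSq β ≠ 0 ∨ ((starRingEnd ℂ) α * β).im ≠ 0)
    (h₁ : CoeffConvertible c α β c' α₁ β₁) (h₂ : CoeffConvertible c α β c' α₂ β₂)
    (g : Fin 3 → ℝ) : LUEquiv (gVec g α₁ β₁) (gVec g α₂ β₂) := by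
  obtain ⟨r₁, -, s₁, x₁, y₁, u₁⟩ := h₁
  obtain ⟨r₂, -, s₂, x₂, y₂, u₂⟩ := h₂
  have hX : ((starRingEnd ℂ) α₁ * β₁).re = ((starRingEnd ℂ) α₂ * β₂).re :=
    mul_left_cancel₀ hc' (x₁.symm.trans x₂)
  have hS := s₁.symm.trans s₂
  have e₁ := normSq_add_sq α₁ β₁
  have e₂ := normSq_add_sq α₂ β₂
  obtain ⟨ε, hε, hU, hY⟩ := sign_of_norm_eq (y := c / c' * ((starRingEnd ℂ) α * β).im)
    (h0.imp id fun h => mul_ne_zero (div_ne_zero hc hc') h) u₁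
    (y₁ := ((starRingEnd ℂ) α₁ * β₁).im) (by field_simp; linear_combination y₁) u₂
    (y₂ := ((starRingEnd ℂ) α₂ * β₂).im) (by field_simp; linear_combination y₂)
    (by rw [hS, hX, e₂] at e₁; linarith)
  exact luEquiv_gVec_of_invariants g hα₁ hβ₁ hS hX hε hY hU

/-- The source of a conversion with given local parameters is unique up to local unitaries. -/
theorem luEquiv_of_common_target {c c' : ℝ} (hc : c ≠ 0) (hc' : c' ≠ 0) {α β α₁ β₁ α₂ β₂ : ℂ}
    (hα₁ : α₁ ≠ 0) (hβ₁ : β₁ ≠ 0)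
    (h0 : normSq α - normSq β ≠ 0 ∨ ((starRingEnd ℂ) α * β).im ≠ 0)
    (h₁ : CoeffConvertible c α₁ β₁ c' α β) (h₂ : CoeffConvertible c α₂ β₂ c' α β)
    (g : Fin 3 → ℝ) : LUEquiv (gVec g α₁ β₁) (gVec g α₂ β₂) := by
  obtain ⟨r₁, -, s₁, x₁, y₁, u₁⟩ := h₁
  obtain ⟨r₂, -, s₂, x₂, y₂, u₂⟩ := h₂
  have hX : ((starRingEnd ℂ) α₁ * β₁).re = ((starRingEnd ℂ) α₂ * β₂).re :=
    mul_left_cancel₀ hc (x₁.trans x₂.symm)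
  have hS := s₁.trans s₂.symm
  have e₁ := normSq_add_sq α₁ β₁
  have e₂ := normSq_add_sq α₂ β₂
  rw [hS, hX, e₂] at e₁
  have hpos : (normSq α - normSq β) ^ 2 + 4 * (c' / c * ((starRingEnd ℂ) α * β).im) ^ 2 ≠ 0 := by
    rcases h0 with h0 | h0 <;> positivity
  have hy₁ : ((starRingEnd ℂ) α₁ * β₁).im = r₁ * (c' / c * ((starRingEnd ℂ) α * β).im) := by
    field_simp; linear_combination y₁
  have hy₂ : ((starRingEnd ℂ) α₂ * β₂).im = r₂ * (c' / c * ((starRingEnd ℂ) α * β).im) := by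
    field_simp; linear_combination y₂
  have hsq : r₁ ^ 2 = r₂ ^ 2 := by
    apply mul_right_cancel₀ hpos
    rw [hy₁, hy₂, u₁, u₂] at e₁
    linear_combination -e₁
  rcases sq_eq_sq_iff_eq_or_eq_neg.mp hsq with hr | hr
  · exact luEquiv_gVec_of_invariants g hα₁ hβ₁ hS hX (Or.inl rfl)
      (by rw [hy₁, hy₂, hr]; ring) (by rw [u₁, u₂, hr]; ring)
  · exact luEquiv_gVec_of_invariants g hα₁ hβ₁ hS hX (Or.inr rfl)
      (by rw [hy₁, hy₂, hr]; ring) (by rw [u₁, u₂, hr]; ring)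

theorem exists_coeffs {s u x y : ℝ} (hs : 0 < s) (hxy : x ≠ 0 ∨ y ≠ 0)
    (h : s ^ 2 = u ^ 2 + 4 * x ^ 2 + 4 * y ^ 2) :
    ∃ α β : ℂ, α ≠ 0 ∧ β ≠ 0 ∧ normSq α + normSq β = s ∧ normSq α - normSq β = u ∧
      ((starRingEnd ℂ) α * β).re = x ∧ ((starRingEnd ℂ) α * β).im = y := by
  have hpos : 0 < x ^ 2 + y ^ 2 := by
    rcases hxy with h0 | h0 <;> positivity
  have hsu : 0 < s + u := by
    have := abs_lt_of_sq_lt_sq (by nlinarith : u ^ 2 < s ^ 2) hs.le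
    linarith [(abs_lt.mp this).1]
  have ha := Real.sqrt_pos.mpr (half_pos hsu)
  have ha2 := Real.sq_sqrt (half_pos hsu).le
  generalize √((s + u) / 2) = a at ha ha2
  have hβ : normSq (⟨x / a, y / a⟩ : ℂ) = (s - u) / 2 := by
    rw [normSq_mk]
    have : x / a * (x / a) + y / a * (y / a) = (x ^ 2 + y ^ 2) / a ^ 2 := by
      field_simp
    rw [this, ha2, div_eq_iff (by linarith)]
    linarith
  have hα : normSq (a : ℂ) = (s + u) / 2 := by rw [normSq_ofReal, ← ha2, sq]
  refine ⟨a, ⟨x / a, y / a⟩, by exact_mod_cast ha.ne', ?_, by rw [hα, hβ]; ring,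
    by rw [hα, hβ]; ring, ?_, ?_⟩
  · rw [← normSq_pos, normSq_mk]
    have : x / a * (x / a) + y / a * (y / a) = (x ^ 2 + y ^ 2) / a ^ 2 := by
      field_simp
    rw [this]
    positivity
  · rw [conj_ofReal, re_ofReal_mul]
    field_simp
  · rw [conj_ofReal, im_ofReal_mul]
    field_simp

/-! ### One-party measurement steps -/

/-- A measurement of party `i` in which the second outcome exchanges the two product terms; the
other parties then apply `σ_x`, which restores the form of the vector. -/
theorem reaches_update {g : Fin 3 → ℝ} (hg : ∀ i, |g i| < 1 / 2) (i : Fin 3) {x : ℝ}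
    (hx : |x| < 1 / 2) {α β α' β' : ℂ} (hα : α ≠ 0) (hβ : β ≠ 0)
    (h : CoeffConvertible (g i) α β x α' β') :
    Reaches (gVec g α β) (gVec (Function.update g i x) α' β') := by
  obtain ⟨r, hr, hS, hX, hY, hU⟩ := h
  obtain ⟨hr1, hr2⟩ := abs_le.mp hr
  -- `p` and `p'` are the amplitudes of the two outcomes.
  have hp := Real.sq_sqrt (by linarith : 0 ≤ (1 + r) / 2)
  have hp' := Real.sq_sqrt (by linarith : 0 ≤ (1 - r) / 2)
  generalize √((1 + r) / 2) = p at hp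
  generalize √((1 - r) / 2) = p' at hp'
  let l : Fin 2 → ℂ := ![p * α' / α, p' * β' / α]
  let m : Fin 2 → ℂ := ![p * β' / β, p' * α' / β]
  let V : Fin 2 → Matrix (Fin 2) (Fin 2) ℂ := ![1, pauliX]
  have hV : ∀ k, (V k)ᴴ * V k = 1 := by
    intro k
    fin_cases k <;> simp [V, pauliX_conjTranspose, pauliX_mul_self]
  let K : Fin 2 → Fin 3 → Matrix (Fin 2) (Fin 2) ℂ := fun k =>
    Function.update (fun _ => V k) i
      (V k * (gMatrix x * Matrix.diagonal ![l k, m k]) * (gMatrix (g i))⁻¹)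
  refine reaches_of_measurement i 2 K ?_ ?_ ![(p : ℂ), (p' : ℂ)] ?_ ?_
  · have hinv := Matrix.mul_nonsing_inv _ (isUnit_det_gMatrix (hg i))
    have key : ∀ k, (K k i)ᴴ * K k i = ((gMatrix (g i))⁻¹)ᴴ *
        ((Matrix.diagonal ![l k, m k])ᴴ * (((gMatrix x)ᴴ * gMatrix x) *
          Matrix.diagonal ![l k, m k])) * (gMatrix (g i))⁻¹ := by
      intro k
      simp only [K, Function.update_self, Matrix.conjTranspose_mul, Matrix.mul_assoc]
      rw [← Matrix.mul_assoc (V k)ᴴ, hV, Matrix.one_mul]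
    have hsum : ∑ k, (Matrix.diagonal ![l k, m k])ᴴ * (((gMatrix x)ᴴ * gMatrix x) *
        Matrix.diagonal ![l k, m k]) = (gMatrix (g i))ᴴ * gMatrix (g i) := by
      rw [gMatrix_conjTranspose_mul hx, gMatrix_conjTranspose_mul (hg i), Fin.sum_univ_two]
      have hα' : (starRingEnd ℂ) α ≠ 0 := by simpa using hα
      have hβ' : (starRingEnd ℂ) β ≠ 0 := by simpa using hβ
      have f₁ : (p : ℂ) ^ 2 * ((starRingEnd ℂ) α' * α') + (p' : ℂ) ^ 2 * ((starRingEnd ℂ) β' * β')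
          = (starRingEnd ℂ) α * α := by
        simp only [← normSq_eq_conj_mul_self]
        norm_cast
        rw [hp, hp']
        linear_combination -(hS + hU) / 2
      have f₂ : (p : ℂ) ^ 2 * ((starRingEnd ℂ) β' * β') + (p' : ℂ) ^ 2 * ((starRingEnd ℂ) α' * α')
          = (starRingEnd ℂ) β * β := by
        simp only [← normSq_eq_conj_mul_self]
        norm_cast
        rw [hp, hp']
        linear_combination -(hS - hU) / 2
      have f₃ : (x : ℂ) * ((p : ℂ) ^ 2 * ((starRingEnd ℂ) α' * β')
          + (p' : ℂ) ^ 2 * ((starRingEnd ℂ) β' * α')) = g i * ((starRingEnd ℂ) α * β) := by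
        rw [← ofReal_pow, ← ofReal_pow, hp, hp']
        apply Complex.ext
        · simp only [re_ofReal_mul, add_re]
          rw [hX]
          simp only [mul_re, conj_re, conj_im]
          ring
        · simp only [im_ofReal_mul, add_im]
          rw [hY]
          simp only [mul_im, conj_re, conj_im]
          ring
      have f₄ := congrArg (starRingEnd ℂ) f₃
      simp only [map_mul, map_add, map_pow, conj_ofReal, conj_conj] at f₄
      ext a b
      fin_cases a <;> fin_cases b <;>
        simp [Matrix.mul_apply, l, m, Matrix.vecMul, dotProduct,
          Matrix.diagonal_apply]
      · field_simp
        linear_combination f₁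
      · field_simp
        linear_combination f₃
      · field_simp
        linear_combination f₄
      · field_simp
        linear_combination f₂
    simp only [key]
    rw [← Matrix.sum_mul, ← Matrix.mul_sum, hsum, ← Matrix.mul_assoc,
      ← Matrix.conjTranspose_mul, hinv, Matrix.conjTranspose_one, Matrix.one_mul, hinv]
  · intro k j hj
    simp only [K, Function.update_of_ne hj, hV]
  · rw [Fin.sum_univ_two]
    simp [hp, hp']
    ring
  · have key : ∀ k, tensorOp (d := qubits) (e := qubits) (K k) *ᵥ gVec g α β
        = tensorOp (d := qubits) (e := qubits) (fun _ => V k) *ᵥ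
          gVec (Function.update g i x) (l k * α) (m k * β) := by
      intro k
      have e : ∀ j, K k j * gMatrix (g j) = (V k * gMatrix (Function.update g i x j)) *
          Matrix.diagonal ![(Function.update (fun _ => 1) i (l k) : Fin 3 → ℂ) j,
            (Function.update (fun _ => 1) i (m k) : Fin 3 → ℂ) j] := by
        intro j
        by_cases hj : j = i
        · subst hj
          simp only [K, Function.update_self, Matrix.mul_assoc]
          rw [Matrix.nonsing_inv_mul _ (isUnit_det_gMatrix (hg j)), Matrix.mul_one]
        · simp only [K, Function.update_of_ne hj]
          have : Matrix.diagonal ![(1 : ℂ), 1] = 1 := by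
            ext a b; fin_cases a <;> fin_cases b <;> simp
          rw [this, Matrix.mul_one]
      rw [gVec, tensorOp_mulVec_mulVec, funext e, tensorOp_mul_diagonal_mulVec_ghzPair, gVec,
        tensorOp_mulVec_mulVec, Finset.prod_update_of_mem (Finset.mem_univ i),
        Finset.prod_update_of_mem (Finset.mem_univ i)]
      simp
    intro k
    rw [key]
    fin_cases k
    · simp only [l, m, V]
      simp only [Fin.zero_eta, Matrix.cons_val_zero, tensorOp_one, Matrix.one_mulVec, smul_gVec]
      rw [div_mul_cancel₀ _ hα, div_mul_cancel₀ _ hβ]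
    · simp only [l, m, V]
      simp only [Fin.mk_one, Matrix.cons_val_one, Matrix.cons_val_fin_one, pauliX_mulVec_gVec,
        smul_gVec]
      rw [div_mul_cancel₀ _ hα, div_mul_cancel₀ _ hβ]

/-! ### Existence of sources and targets -/

theorem CoeffConvertible.mul_left {c c' : ℝ} {α β α' β' : ℂ} (h : CoeffConvertible c α β c' α' β')
    (k : ℝ) : CoeffConvertible (k * c) α β (k * c') α' β' := by
  obtain ⟨r, hr, hS, hX, hY, hU⟩ := h
  exact ⟨r, hr, hS, by linear_combination k * hX, by linear_combination k * hY, hU⟩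

theorem CoeffConvertible.trans {c c' c'' : ℝ} {α β α' β' α'' β'' : ℂ}
    (h : CoeffConvertible c α β c' α' β') (h' : CoeffConvertible c' α' β' c'' α'' β'') :
    CoeffConvertible c α β c'' α'' β'' := by
  obtain ⟨r, hr, hS, hX, hY, hU⟩ := h
  obtain ⟨r', hr', hS', hX', hY', hU'⟩ := h'
  refine ⟨r * r', ?_, hS.trans hS', hX.trans hX', by rw [hY, hY']; ring, by rw [hU, hU']; ring⟩
  rw [abs_mul]
  exact mul_le_one₀ hr (abs_nonneg _) hr'

/-- If `|α'|² = |β'|²` and `ᾱ' β'` is real, then so it is for every source. -/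
theorem CoeffConvertible.target_generic {c c' : ℝ} {α β α' β' : ℂ} (hc : c ≠ 0)
    (h : CoeffConvertible c α β c' α' β')
    (h0 : normSq α - normSq β ≠ 0 ∨ ((starRingEnd ℂ) α * β).im ≠ 0) :
    normSq α' - normSq β' ≠ 0 ∨ ((starRingEnd ℂ) α' * β').im ≠ 0 := by
  obtain ⟨r, -, -, -, hY, hU⟩ := h
  by_contra! hc'
  rw [hc'.1, mul_zero] at hU
  rw [hc'.2, mul_zero, mul_zero] at hY
  rcases h0 with h0 | h0
  · exact h0 hU
  · exact h0 ((mul_eq_zero.mp hY).resolve_left hc)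

theorem re_ne_zero_or_im_ne_zero {α β : ℂ} (hα : α ≠ 0) (hβ : β ≠ 0) :
    ((starRingEnd ℂ) α * β).re ≠ 0 ∨ ((starRingEnd ℂ) α * β).im ≠ 0 := by
  by_contra! hc
  have : (starRingEnd ℂ) α * β = 0 := Complex.ext hc.1 hc.2
  simp [hα, hβ] at this

/-- Increasing the product of the local parameters is always compatible with the conditions on the
coefficients. -/
theorem exists_target_coeffs {c c' : ℝ} (hc : 0 < c) (hcc : c ≤ c') {α β : ℂ} (hα : α ≠ 0)
    (hβ : β ≠ 0) (h0 : normSq α - normSq β ≠ 0 ∨ ((starRingEnd ℂ) α * β).im ≠ 0) :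
    ∃ α' β' : ℂ, α' ≠ 0 ∧ β' ≠ 0 ∧ CoeffConvertible c α β c' α' β' := by
  have hc' : 0 < c' := hc.trans_le hcc
  have hs := normSq_add_pos hα β
  have hxy := re_ne_zero_or_im_ne_zero hα hβ
  have e := normSq_add_sq α β
  unfold CoeffConvertible
  generalize normSq α + normSq β = s at *
  generalize normSq α - normSq β = u at *
  generalize ((starRingEnd ℂ) α * β).re = x at *
  generalize ((starRingEnd ℂ) α * β).im = y at *
  obtain ⟨t, ht⟩ : ∃ t, t = c / c' := ⟨_, rfl⟩
  have ht0 : 0 < t := by rw [ht]; positivity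
  have ht1 : t ≤ 1 := by rw [ht]; exact (div_le_one hc').mpr hcc
  have hct : c = c' * t := by rw [ht]; field_simp
  have ht2 : t ^ 2 ≤ 1 := pow_le_one₀ ht0.le ht1
  -- The identity `normSq_add_sq` for the target forces
  -- `r ^ 2 = (u ^ 2 + 4 * t ^ 2 * y ^ 2) / (s ^ 2 - 4 * t ^ 2 * x ^ 2)`.
  have hnum : 0 < u ^ 2 + 4 * t ^ 2 * y ^ 2 := by
    rcases h0 with h0 | h0 <;> positivity
  have hle : u ^ 2 + 4 * t ^ 2 * y ^ 2 ≤ s ^ 2 - 4 * t ^ 2 * x ^ 2 := by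
    nlinarith [mul_nonneg (sub_nonneg.mpr ht2) (sq_nonneg x),
      mul_nonneg (sub_nonneg.mpr ht2) (sq_nonneg y)]
  have hden := hnum.trans_le hle
  have hr := Real.sqrt_pos.mpr (div_pos hnum hden)
  have hr2 := Real.sq_sqrt (div_pos hnum hden).le
  have hr1 : √((u ^ 2 + 4 * t ^ 2 * y ^ 2) / (s ^ 2 - 4 * t ^ 2 * x ^ 2)) ≤ 1 :=
    Real.sqrt_le_one.mpr ((div_le_one hden).mpr hle)
  generalize √((u ^ 2 + 4 * t ^ 2 * y ^ 2) / (s ^ 2 - 4 * t ^ 2 * x ^ 2)) = r at *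
  have hxy' : t * x ≠ 0 ∨ t * y / r ≠ 0 := hxy.imp (fun h => mul_ne_zero ht0.ne' h)
    fun h => div_ne_zero (mul_ne_zero ht0.ne' h) hr.ne'
  obtain ⟨α', β', hα', hβ', e1, e2, e3, e4⟩ := exists_coeffs (u := u / r) hs hxy' (by
    rw [eq_div_iff hden.ne'] at hr2
    field_simp
    linear_combination hr2)
  refine ⟨α', β', hα', hβ', r, by rw [abs_of_pos hr]; exact hr1, e1.symm, ?_, ?_, ?_⟩
  · rw [e3, hct]; ring
  · rw [e4, hct]; field_simp
  · rw [e2]; field_simp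

/-- A source with local parameters of product `c` exists as soon as the conserved quantity
`c Re (ᾱ β)` allows `2 |Re (ᾱ β)| < |α|² + |β|²`. -/
theorem exists_source_coeffs {c c' : ℝ} (hc : 0 < c) (hcc : c ≤ c') {α' β' : ℂ} (hα : α' ≠ 0)
    (hβ : β' ≠ 0) (h0 : normSq α' - normSq β' ≠ 0 ∨ ((starRingEnd ℂ) α' * β').im ≠ 0)
    (hlt : c' * (2 * |((starRingEnd ℂ) α' * β').re|) < c * (normSq α' + normSq β')) :
    ∃ α β : ℂ, α ≠ 0 ∧ β ≠ 0 ∧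
      (normSq α - normSq β ≠ 0 ∨ ((starRingEnd ℂ) α * β).im ≠ 0) ∧
      CoeffConvertible c α β c' α' β' := by
  have hc' : 0 < c' := hc.trans_le hcc
  have hs := normSq_add_pos hα β'
  have hxy := re_ne_zero_or_im_ne_zero hα hβ
  have e := normSq_add_sq α' β'
  unfold CoeffConvertible
  generalize normSq α' + normSq β' = s at *
  generalize normSq α' - normSq β' = u at *
  generalize ((starRingEnd ℂ) α' * β').re = x at *
  generalize ((starRingEnd ℂ) α' * β').im = y at *
  obtain ⟨t, ht⟩ : ∃ t, t = c' / c := ⟨_, rfl⟩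
  have ht1 : 1 ≤ t := by rw [ht]; exact (one_le_div hc).mpr hcc
  have ht0 : 0 < t := by linarith
  have hct : c' = c * t := by rw [ht]; field_simp
  have ht2 : 1 ≤ t ^ 2 := one_le_pow₀ ht1
  -- The identity `normSq_add_sq` for the source forces
  -- `r ^ 2 = (s ^ 2 - 4 * t ^ 2 * x ^ 2) / (u ^ 2 + 4 * t ^ 2 * y ^ 2)`.
  have hden : 0 < u ^ 2 + 4 * t ^ 2 * y ^ 2 := by
    rcases h0 with h0 | h0 <;> positivity
  have hnum : 0 < s ^ 2 - 4 * t ^ 2 * x ^ 2 := by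
    have h1 : t * (2 * |x|) < s := by
      rw [hct, mul_assoc] at hlt
      exact lt_of_mul_lt_mul_left hlt hc.le
    have h2 : (t * (2 * |x|)) ^ 2 < s ^ 2 := pow_lt_pow_left₀ h1 (by positivity) two_ne_zero
    rw [mul_pow, mul_pow, sq_abs] at h2
    linarith
  have hle : s ^ 2 - 4 * t ^ 2 * x ^ 2 ≤ u ^ 2 + 4 * t ^ 2 * y ^ 2 := by
    nlinarith [mul_nonneg (sub_nonneg.mpr ht2) (sq_nonneg x),
      mul_nonneg (sub_nonneg.mpr ht2) (sq_nonneg y)]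
  have hr := Real.sqrt_pos.mpr (div_pos hnum hden)
  have hr2 := Real.sq_sqrt (div_pos hnum hden).le
  have hr1 : √((s ^ 2 - 4 * t ^ 2 * x ^ 2) / (u ^ 2 + 4 * t ^ 2 * y ^ 2)) ≤ 1 :=
    Real.sqrt_le_one.mpr ((div_le_one hden).mpr hle)
  generalize √((s ^ 2 - 4 * t ^ 2 * x ^ 2) / (u ^ 2 + 4 * t ^ 2 * y ^ 2)) = r at *
  have hxy' : t * x ≠ 0 ∨ r * (t * y) ≠ 0 := hxy.imp (fun h => mul_ne_zero ht0.ne' h)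
    fun h => mul_ne_zero hr.ne' (mul_ne_zero ht0.ne' h)
  obtain ⟨α, β, hα', hβ', e1, e2, e3, e4⟩ := exists_coeffs (u := r * u) hs hxy' (by
    rw [eq_div_iff hden.ne'] at hr2
    linear_combination -hr2)
  refine ⟨α, β, hα', hβ', ?_, r, by rw [abs_of_pos hr]; exact hr1, e1, ?_, ?_, ?_⟩
  · rw [e2, e4]
    exact h0.imp (mul_ne_zero hr.ne') fun h => mul_ne_zero hr.ne' (mul_ne_zero ht0.ne' h)
  · rw [e3, hct]; ring
  · rw [e4, hct]; ring
  · rw [e2]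

/-! ### Sufficient conditions for conversion -/

/-- Unless `|α|² = |β|²` and `ᾱ β` is real, the necessary conditions are sufficient: the parties
change their local parameters one after the other. -/
theorem reaches_of_coeffConvertible {g h : Fin 3 → ℝ} (hg : ∀ i, 0 < g i) (hgh : ∀ i, g i ≤ h i)
    (hh : ∀ i, h i < 1 / 2) {α β α' β' : ℂ} (hα : α ≠ 0) (hβ : β ≠ 0)
    (h0 : normSq α - normSq β ≠ 0 ∨ ((starRingEnd ℂ) α * β).im ≠ 0)
    (H : CoeffConvertible (g 0 * g 1 * g 2) α β (h 0 * h 1 * h 2) α' β') :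
    Reaches (gVec g α β) (gVec h α' β') := by
  have hh0 : ∀ i, 0 < h i := fun i => (hg i).trans_le (hgh i)
  have ag : ∀ i, |g i| < 1 / 2 := fun i => by
    rw [abs_of_pos (hg i)]; exact (hgh i).trans_lt (hh i)
  have ah : ∀ i, |h i| < 1 / 2 := fun i => by rw [abs_of_pos (hh0 i)]; exact hh i
  have upd : ∀ {f : Fin 3 → ℝ} (i : Fin 3), (∀ j, |f j| < 1 / 2) →
      ∀ j, |Function.update f i (h i) j| < 1 / 2 := by
    intro f i hf j
    by_cases hj : j = i
    · subst hj; simpa using ah j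
    · simpa [hj] using hf j
  obtain ⟨α₁, β₁, hα₁, hβ₁, H₁⟩ := exists_target_coeffs (hg 0) (hgh 0) hα hβ h0
  have h0₁ := H₁.target_generic (hg 0).ne' h0
  obtain ⟨α₂, β₂, hα₂, hβ₂, H₂⟩ := exists_target_coeffs (hg 1) (hgh 1) hα₁ hβ₁ h0₁
  have h0₂ := H₂.target_generic (hg 1).ne' h0₁
  obtain ⟨α₃, β₃, hα₃, hβ₃, H₃⟩ := exists_target_coeffs (hg 2) (hgh 2) hα₂ hβ₂ h0₂
  have R₁ := reaches_update ag 0 (ah 0) hα hβ H₁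
  have R₂ := reaches_update (upd 0 ag) 1 (ah 1) hα₁ hβ₁ (x := h 1) (by simpa using H₂)
  have R₃ := reaches_update (upd 1 (upd 0 ag)) 2 (ah 2) hα₂ hβ₂ (x := h 2) (by simpa using H₃)
  have e : Function.update (Function.update (Function.update g 0 (h 0)) 1 (h 1)) 2 (h 2) = h := by
    ext i; fin_cases i <;> rfl
  rw [e] at R₃
  have C : CoeffConvertible (g 0 * g 1 * g 2) α β (h 0 * h 1 * h 2) α₃ β₃ := by
    have C₁ := H₁.mul_left (g 1 * g 2)
    have C₂ := H₂.mul_left (h 0 * g 2)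
    have C₃ := H₃.mul_left (h 0 * h 1)
    rw [show g 1 * g 2 * g 0 = g 0 * g 1 * g 2 by ring,
      show g 1 * g 2 * h 0 = h 0 * g 2 * g 1 by ring] at C₁
    rw [show h 0 * g 2 * h 1 = h 0 * h 1 * g 2 by ring] at C₂
    exact (C₁.trans C₂).trans C₃
  have L := luEquiv_of_common_source (mul_pos (mul_pos (hg 0) (hg 1)) (hg 2)).ne'
    (mul_pos (mul_pos (hh0 0) (hh0 1)) (hh0 2)).ne' hα₃ hβ₃ h0 C H h
  exact ((R₁.trans R₂).trans R₃).trans L.reaches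

/-! ### Normal form of the GHZ class and its maximally entangled set -/

theorem exists_unitary_mul_eq {A B : Matrix (Fin 2) (Fin 2) ℂ} (hB : IsUnit B.det)
    (h : Aᴴ * A = Bᴴ * B) : ∃ U : Matrix.unitaryGroup (Fin 2) ℂ,
      A = (U : Matrix (Fin 2) (Fin 2) ℂ) * B := by
  refine ⟨⟨A * B⁻¹, ?_⟩, ?_⟩
  · rw [Matrix.mem_unitaryGroup_iff', Matrix.star_eq_conjTranspose, Matrix.conjTranspose_mul,
      Matrix.mul_assoc, ← Matrix.mul_assoc Aᴴ, h, Matrix.mul_assoc, Matrix.mul_nonsing_inv _ hB,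
      Matrix.mul_one, ← Matrix.conjTranspose_mul, Matrix.mul_nonsing_inv _ hB,
      Matrix.conjTranspose_one]
  · rw [Matrix.mul_assoc, Matrix.nonsing_inv_mul _ hB, Matrix.mul_one]

/-- Every invertible one-qubit operator factors into a unitary, some `g_x` and a diagonal matrix:
rescale its columns to the same norm and to a nonnegative inner product. -/
theorem exists_unitary_gMatrix_diagonal {K : Matrix (Fin 2) (Fin 2) ℂ} (hK : IsUnit K.det) :
    ∃ (U : Matrix.unitaryGroup (Fin 2) ℂ) (x : ℝ) (l m : ℂ), 0 ≤ x ∧ x < 1 / 2 ∧ l ≠ 0 ∧ m ≠ 0 ∧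
      K = (U : Matrix (Fin 2) (Fin 2) ℂ) * (gMatrix x * Matrix.diagonal ![l, m]) := by
  obtain ⟨a, ha⟩ : ∃ a, a = normSq (K 0 0) + normSq (K 1 0) := ⟨_, rfl⟩
  obtain ⟨b, hb⟩ : ∃ b, b = normSq (K 0 1) + normSq (K 1 1) := ⟨_, rfl⟩
  obtain ⟨w, hw⟩ : ∃ w, w = (starRingEnd ℂ) (K 0 0) * K 0 1 + (starRingEnd ℂ) (K 1 0) * K 1 1 :=
    ⟨_, rfl⟩
  have hdet : normSq K.det = a * b - ‖w‖ ^ 2 := by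
    rw [← normSq_eq_norm_sq, ha, hb, hw, Matrix.det_fin_two]
    simp only [normSq_apply, mul_re, mul_im, conj_re, conj_im, sub_re, sub_im, add_re, add_im]
    ring
  have hd : 0 < normSq K.det := normSq_pos.mpr hK.ne_zero
  have ha0 : 0 ≤ a := by rw [ha]; exact add_nonneg (normSq_nonneg _) (normSq_nonneg _)
  have hb0 : 0 ≤ b := by rw [hb]; exact add_nonneg (normSq_nonneg _) (normSq_nonneg _)
  have hab : ‖w‖ ^ 2 < a * b := by linarith
  have hab0 : 0 < a * b := lt_of_le_of_lt (sq_nonneg _) hab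
  have ha1 : 0 < a := lt_of_le_of_ne ha0 fun h => by rw [← h, zero_mul] at hab0; exact hab0.false
  have hb1 : 0 < b := lt_of_le_of_ne hb0 fun h => by rw [← h, mul_zero] at hab0; exact hab0.false
  have sa := Real.sqrt_pos.mpr (mul_pos two_pos ha1)
  have sb := Real.sqrt_pos.mpr (mul_pos two_pos hb1)
  have sa2 := Real.sq_sqrt (mul_pos two_pos ha1).le
  have sb2 := Real.sq_sqrt (mul_pos two_pos hb1).le
  generalize √(2 * a) = p at sa sa2
  generalize √(2 * b) = q at sb sb2
  obtain ⟨e, he, hwe⟩ : ∃ e : ℂ, ‖e‖ = 1 ∧ w = ‖w‖ * e :=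
    ⟨exp (arg w * I), norm_exp_ofReal_mul_I _, (norm_mul_exp_arg_mul_I w).symm⟩
  have he2 : (starRingEnd ℂ) e * e = 1 := by
    rw [← normSq_eq_conj_mul_self, normSq_eq_norm_sq, he]; simp
  have he0 : e ≠ 0 := by rintro rfl; simp at he
  have hpq : 0 < p * q := mul_pos sa sb
  have hx0 : 0 ≤ ‖w‖ / (p * q) := by positivity
  have hx1 : ‖w‖ / (p * q) < 1 / 2 := by
    rw [div_lt_iff₀ hpq]
    apply lt_of_pow_lt_pow_left₀ 2 (by positivity)
    calc ‖w‖ ^ 2 < a * b := hab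
      _ = (1 / 2 * (p * q)) ^ 2 := by rw [mul_pow, mul_pow, sa2, sb2]; ring
  have hl0 : (p : ℂ) ≠ 0 := by exact_mod_cast sa.ne'
  have hq0 : (q : ℂ) ≠ 0 := by exact_mod_cast sb.ne'
  have hm0 : (q : ℂ) * e ≠ 0 := mul_ne_zero hq0 he0
  have hax : |‖w‖ / (p * q)| < 1 / 2 := by rwa [abs_of_nonneg hx0]
  obtain ⟨U, hU⟩ := exists_unitary_mul_eq (A := K)
    (B := gMatrix (‖w‖ / (p * q)) * Matrix.diagonal ![(p : ℂ), q * e])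
    (by
      rw [Matrix.det_mul, Matrix.det_diagonal, Fin.prod_univ_two]
      exact (isUnit_det_gMatrix hax).mul (mul_ne_zero hl0 hm0).isUnit)
    (by
      rw [Matrix.conjTranspose_mul, Matrix.mul_assoc, ← Matrix.mul_assoc (gMatrix _)ᴴ,
        gMatrix_conjTranspose_mul hax]
      have sa2' : (p : ℂ) ^ 2 = 2 * a := by exact_mod_cast sa2
      have sb2' : (q : ℂ) ^ 2 = 2 * b := by exact_mod_cast sb2
      have ha' : (a : ℂ) = (starRingEnd ℂ) (K 0 0) * K 0 0 + (starRingEnd ℂ) (K 1 0) * K 1 0 := by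
        rw [ha, ofReal_add, normSq_eq_conj_mul_self, normSq_eq_conj_mul_self]
      have hb' : (b : ℂ) = (starRingEnd ℂ) (K 0 1) * K 0 1 + (starRingEnd ℂ) (K 1 1) * K 1 1 := by
        rw [hb, ofReal_add, normSq_eq_conj_mul_self, normSq_eq_conj_mul_self]
      have hw' : (‖w‖ : ℂ) * e
          = (starRingEnd ℂ) (K 0 0) * K 0 1 + (starRingEnd ℂ) (K 1 0) * K 1 1 := by
        rw [← hwe, hw]
      have hw'' := congrArg (starRingEnd ℂ) hw'
      simp only [map_mul, map_add, conj_ofReal, conj_conj] at hw''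
      ext i j
      fin_cases i <;> fin_cases j <;>
        simp [Matrix.mul_apply, Fin.sum_univ_two, Matrix.vecMul, dotProduct,
          Matrix.diagonal_apply]
      · linear_combination -ha' - sa2' / 2
      · field_simp
        linear_combination -hw'
      · field_simp
        linear_combination -hw''
      · linear_combination -hb' - sb2' / 2 - (q : ℂ) ^ 2 * he2 / 2)
  exact ⟨U, _, _, _, hx0, hx1, hl0, hm0, hU⟩

/-- Every vector that local invertible operators take into the GHZ class has the normal form
`gVec g α β` up to local unitaries. -/
theorem exists_luEquiv_gVec {K : Fin 3 → Matrix (Fin 2) (Fin 2) ℂ} (hK : ∀ i, IsUnit (K i).det)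
    {h : Fin 3 → ℝ} (hh : ∀ i, |h i| < 1 / 2) {α β c : ℂ} (hα : α ≠ 0) (hβ : β ≠ 0) (hc : c ≠ 0)
    {φ : Ket qubits} (hφ : tensorOp (d := qubits) (e := qubits) K *ᵥ φ = c • gVec h α β) :
    ∃ (g : Fin 3 → ℝ) (α' β' : ℂ), (∀ i, 0 ≤ g i ∧ g i < 1 / 2) ∧ α' ≠ 0 ∧ β' ≠ 0 ∧
      LUEquiv φ (gVec g α' β') := by
  have hA : ∀ i, IsUnit ((K i)⁻¹ * gMatrix (h i)).det := fun i => by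
    rw [Matrix.det_mul]
    exact (Matrix.isUnit_nonsing_inv_det _ (hK i)).mul (isUnit_det_gMatrix (hh i))
  choose U x l m hx0 hx1 hl hm hU using fun i => exists_unitary_gMatrix_diagonal (hA i)
  have e : φ = tensorOp (d := qubits) (e := qubits) (fun i => (K i)⁻¹ * gMatrix (h i)) *ᵥ
      ghzPair (c * α) (c * β) := by
    have := congrArg (fun v => tensorOp (d := qubits) (e := qubits) (fun i => (K i)⁻¹) *ᵥ v) hφ
    simp only [tensorOp_mulVec_mulVec, fun i => Matrix.nonsing_inv_mul _ (hK i), tensorOp_one,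
      Matrix.one_mulVec] at this
    rw [this, smul_gVec, gVec, tensorOp_mulVec_mulVec]
  rw [funext hU] at e
  simp only [← Matrix.mul_assoc] at e
  rw [tensorOp_mul_diagonal_mulVec_ghzPair, ← tensorOp_mulVec_mulVec, ← gVec] at e
  refine ⟨x, _, _, fun i => ⟨hx0 i, hx1 i⟩, ?_, ?_, luEquiv_equivalence.symm ⟨U, e⟩⟩
  · exact mul_ne_zero (Finset.prod_ne_zero_iff.mpr fun i _ => hl i) (mul_ne_zero hc hα)
  · exact mul_ne_zero (Finset.prod_ne_zero_iff.mpr fun i _ => hm i) (mul_ne_zero hc hβ)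

theorem eq_of_le_of_prod_eq {f g : Fin 3 → ℝ} (hf : ∀ i, 0 ≤ f i) (hg : ∀ i, 0 < g i)
    (hfg : ∀ i, f i ≤ g i) (h : f 0 * f 1 * f 2 = g 0 * g 1 * g 2) : f = g := by
  have hG : 0 < ∏ i, g i := Finset.prod_pos fun i _ => hg i
  rw [← Fin.prod_univ_three, ← Fin.prod_univ_three] at h
  have hf0 : ∀ i, 0 < f i := by
    intro i
    refine lt_of_le_of_ne (hf i) fun h0 => ?_
    rw [Finset.prod_eq_zero (Finset.mem_univ i) h0.symm] at h
    exact hG.ne h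
  ext i
  refine le_antisymm (hfg i) (not_lt.mp fun hlt => ?_)
  exact (Finset.prod_lt_prod (fun j _ => hf0 j) (fun j _ => hfg j) ⟨i, Finset.mem_univ i, hlt⟩).ne h

/-- If `|α|² = |β|²` and `ᾱ β` is real, then no other entangled state can be converted into the
vector. -/
theorem inMES_gVec {g : Fin 3 → ℝ} (hg : ∀ i, 0 < g i ∧ g i < 1 / 2) {α β : ℂ} (hα : α ≠ 0)
    (hβ : β ≠ 0) (hn : ∑ a, ‖gVec g α β a‖ ^ 2 = 1) (hU : normSq α - normSq β = 0)
    (hY : ((starRingEnd ℂ) α * β).im = 0) : InMES (gVec g α β) := by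
  have ag : ∀ i, |g i| < 1 / 2 := fun i => by rw [abs_of_pos (hg i).1]; exact (hg i).2
  refine ⟨⟨hn, not_isProductAcross_gVec ag hα hβ⟩, fun φ hφ hR => ?_⟩
  obtain ⟨ι, _, K, c, hsum, hK⟩ := hR.exists_kraus hφ.2 (not_isProductAcross_gVec ag hα hβ)
  obtain ⟨k⟩ : Nonempty ι := by
    by_contra hne
    rw [not_nonempty_iff] at hne
    rw [Finset.univ_eq_empty, Finset.sum_empty] at hsum
    exact zero_ne_one hsum
  obtain ⟨f, α', β', hf, hα', hβ', hL⟩ := exists_luEquiv_gVec (hK k).2.2 ag hα hβ (hK k).2.1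
    (hK k).1
  have hR' := (luEquiv_equivalence.symm hL).reaches.trans hR
  have af : ∀ i, |f i| < 1 / 2 := fun i => by rw [abs_of_nonneg (hf i).1]; exact (hf i).2
  obtain ⟨hle, r, hr, hS', hX', hY', hU'⟩ := hR'.necessary af (fun i => ⟨(hg i).1.le, (hg i).2⟩)
    hα' hβ' hα hβ (hL.isEntangledState hφ).1 hn
  rw [hU, mul_zero] at hU'
  rw [hY, mul_zero, mul_zero] at hY'
  have hGp : 0 < g 0 * g 1 * g 2 := mul_pos (mul_pos (hg 0).1 (hg 1).1) (hg 2).1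
  have hFp : 0 ≤ f 0 * f 1 * f 2 := mul_nonneg (mul_nonneg (hf 0).1 (hf 1).1) (hf 2).1
  have hFG : f 0 * f 1 * f 2 ≤ g 0 * g 1 * g 2 :=
    mul_le_mul (mul_le_mul (hle 0) (hle 1) (hf 1).1 (hg 0).1.le) (hle 2) (hf 2).1
      (mul_pos (hg 0).1 (hg 1).1).le
  have e := normSq_add_sq α β
  have e' := normSq_add_sq α' β'
  have hs := normSq_add_pos hα β
  rw [hU, hY] at e
  rw [hS', hU'] at e'
  have hGF : g 0 * g 1 * g 2 ≤ f 0 * f 1 * f 2 := by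
    generalize f 0 * f 1 * f 2 = F at *
    generalize g 0 * g 1 * g 2 = G at *
    generalize normSq α + normSq β = s at *
    generalize ((starRingEnd ℂ) α' * β').re = x' at *
    generalize ((starRingEnd ℂ) α' * β').im = y' at *
    generalize ((starRingEnd ℂ) α * β).re = x at *
    apply le_of_sq_le_sq _ hFp
    apply le_of_mul_le_mul_right _ (pow_pos hs 2)
    have h1 : G ^ 2 * s ^ 2 = 4 * (G * x) ^ 2 := by rw [e]; ring
    rw [h1, ← hX', e']
    nlinarith [mul_nonneg (sq_nonneg F) (sq_nonneg y')]
  have hfg := eq_of_le_of_prod_eq (fun i => (hf i).1) (fun i => (hg i).1) hle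
    (le_antisymm hFG hGF)
  subst hfg
  refine luEquiv_equivalence.trans hL
    (luEquiv_gVec_of_invariants f hα' hβ' hS' (mul_left_cancel₀ hGp.ne' hX') (Or.inl rfl) ?_ ?_)
  · rw [hY, mul_zero]
    exact (mul_eq_zero.mp hY').resolve_left hGp.ne'
  · rw [hU, hU', mul_zero]

/-! ### The states `Ψ(g, z)` and their classes -/

theorem sum_norm_sq_gVec_pos {g : Fin 3 → ℝ} (hg : ∀ i, |g i| < 1 / 2) {α β : ℂ} (hα : α ≠ 0)
    (hβ : β ≠ 0) : 0 < ∑ a, ‖gVec g α β a‖ ^ 2 := by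
  refine lt_of_le_of_ne (Finset.sum_nonneg fun a _ => by positivity) fun h => ?_
  apply not_isProductAcross_gVec hg hα hβ 0
  have h0 := (Finset.sum_eq_zero_iff_of_nonneg fun a _ => by positivity).mp h.symm
  refine ⟨0, 0, fun a => ?_⟩
  simpa using h0 a (Finset.mem_univ a)

theorem sum_norm_sq_smul {d : Fin 3 → ℕ} (c : ℂ) (ψ : Ket d) :
    ∑ a, ‖(c • ψ) a‖ ^ 2 = ‖c‖ ^ 2 * ∑ a, ‖ψ a‖ ^ 2 := by
  rw [Finset.mul_sum]
  exact Finset.sum_congr rfl fun a _ => by rw [Pi.smul_apply, norm_smul, mul_pow]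

theorem ghzState_eq {g : Fin 3 → ℝ} (hg : ∀ i, |g i| < 1 / 2) {z : ℂ} (hz : z ≠ 0) :
    ∃ k : ℝ, 0 < k ∧ ghzState g z = gVec g (k * z) (k * (1 / z)) ∧
      ∑ a, ‖ghzState g z a‖ ^ 2 = 1 := by
  have h2 : (0 : ℝ) < 1 / √2 := by positivity
  have h2' : ((1 / √2 : ℝ) : ℂ) ≠ 0 := by exact_mod_cast h2.ne'
  have hN := sum_norm_sq_gVec_pos hg (mul_ne_zero h2' hz)
    (mul_ne_zero h2' (one_div_ne_zero hz))
  rw [← ghzVector_eq] at hN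
  refine ⟨1 / √(∑ a, ‖ghzVector g z a‖ ^ 2) * (1 / √2), by positivity, ?_, ?_⟩
  · rw [ghzState, ghzVector_eq, smul_gVec, ← mul_assoc, ← mul_assoc]
    push_cast
    rfl
  · rw [ghzState, sum_norm_sq_smul, norm_real, Real.norm_of_nonneg (by positivity), div_pow,
      Real.sq_sqrt hN.le, one_pow, one_div_mul_cancel hN.ne']

theorem ghzState_spec {g : Fin 3 → ℝ} (hg : ∀ i, |g i| < 1 / 2) {z : ℂ} (hz : z ≠ 0) :
    ∃ α β : ℂ, α ≠ 0 ∧ β ≠ 0 ∧ ghzState g z = gVec g α β ∧ ∑ a, ‖gVec g α β a‖ ^ 2 = 1 ∧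
      2 * |((starRingEnd ℂ) α * β).re| = fParam z * (normSq α + normSq β) ∧
      (normSq α - normSq β = 0 → ‖z‖ = 1) := by
  obtain ⟨k, hk, e, hn⟩ := ghzState_eq hg hz
  have hk' : (k : ℂ) ≠ 0 := by exact_mod_cast hk.ne'
  have hzn : 0 < normSq z := normSq_pos.mpr hz
  have h4 : ‖z‖ ^ 4 = normSq z ^ 2 := by rw [normSq_eq_norm_sq]; ring
  refine ⟨_, _, mul_ne_zero hk' hz, mul_ne_zero hk' (one_div_ne_zero hz), e, by rwa [← e], ?_, ?_⟩
  · have e1 : (starRingEnd ℂ) (k * z) * (k * (1 / z))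
        = ((k ^ 2 / normSq z : ℝ) : ℂ) * (starRingEnd ℂ) (z ^ 2) := by
      have hc : (starRingEnd ℂ) z ≠ 0 := by simpa using hz
      push_cast
      rw [normSq_eq_conj_mul_self, map_mul, conj_ofReal, map_pow]
      field_simp
    rw [e1, re_ofReal_mul, conj_re, abs_mul, abs_of_nonneg (by positivity), fParam, normSq_mul,
      normSq_mul, normSq_div, normSq_one, normSq_ofReal, h4]
    field_simp
    ring
  · intro h
    rw [normSq_mul, normSq_mul, normSq_div, normSq_one, normSq_ofReal] at h
    have h1 : normSq z ^ 2 = 1 := by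
      field_simp at h
      nlinarith [h, mul_pos hk hk]
    have h2 : normSq z = 1 := (pow_eq_one_iff_of_nonneg hzn.le two_ne_zero).mp h1
    rw [normSq_eq_norm_sq] at h2
    exact (pow_eq_one_iff_of_nonneg (norm_nonneg z) two_ne_zero).mp h2

theorem IsGeneric.abs_lt {g : Fin 3 → ℝ} {z : ℂ} (h : IsGeneric g z) (i : Fin 3) :
    |g i| < 1 / 2 := by
  rw [abs_of_pos (h.1 i).1]
  exact (h.1 i).2

theorem IsGeneric.spec {g : Fin 3 → ℝ} {z : ℂ} (h : IsGeneric g z) :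
    ∃ α β : ℂ, α ≠ 0 ∧ β ≠ 0 ∧ ghzState g z = gVec g α β ∧ ∑ a, ‖gVec g α β a‖ ^ 2 = 1 ∧
      2 * |((starRingEnd ℂ) α * β).re| = fParam z * (normSq α + normSq β) ∧
      (normSq α - normSq β ≠ 0 ∨ ((starRingEnd ℂ) α * β).im ≠ 0) := by
  obtain ⟨α, β, hα, hβ, e, hn, hf, -⟩ := ghzState_spec h.abs_lt h.2.1
  refine ⟨α, β, hα, hβ, e, hn, hf, ?_⟩
  by_contra! hc
  apply h.2.2.2
  rw [e]
  exact inMES_gVec h.1 hα hβ hn hc.1 hc.2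

/-- Every normalised vector of the GHZ class is represented by some `z` in the unit disc: `z²` is
the ratio of the coefficients, which may be exchanged. -/
theorem exists_luEquiv_ghzState {h : Fin 3 → ℝ} (hh : ∀ i, |h i| < 1 / 2) {α β : ℂ} (hα : α ≠ 0)
    (hβ : β ≠ 0) (hn : ∑ a, ‖gVec h α β a‖ ^ 2 = 1) :
    ∃ z : ℂ, z ≠ 0 ∧ ‖z‖ ≤ 1 ∧ LUEquiv (gVec h α β) (ghzState h z) := by
  wlog hle : ‖α‖ ≤ ‖β‖ generalizing α β
  · have hs := luEquiv_gVec_swap h α β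
    have hn' := (hs.isEntangledState ⟨hn, not_isProductAcross_gVec hh hα hβ⟩).1
    obtain ⟨z, hz, hz1, hL⟩ := this hβ hα hn' (not_le.mp hle).le
    exact ⟨z, hz, hz1, luEquiv_equivalence.trans hs hL⟩
  obtain ⟨z, hz⟩ := IsAlgClosed.exists_pow_nat_eq (α / β) two_pos
  have hz0 : z ≠ 0 := by
    rintro rfl
    rw [zero_pow two_ne_zero] at hz
    exact div_ne_zero hα hβ hz.symm
  refine ⟨z, hz0, ?_, ?_⟩
  · have : ‖z‖ ^ 2 ≤ 1 := by
      rw [← norm_pow, hz, norm_div]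
      exact div_le_one_of_le₀ hle (norm_nonneg _)
    exact (sq_le_one_iff₀ (norm_nonneg z)).mp this
  · obtain ⟨k, hk, e, hn'⟩ := ghzState_eq hh hz0
    have hk' : (k : ℂ) ≠ 0 := by exact_mod_cast hk.ne'
    have e2 : gVec h α β = (β * z / k) • ghzState h z := by
      rw [e, smul_gVec]
      congr 1
      · field_simp
        rw [hz]
        field_simp
      · field_simp
    rw [e2] at hn ⊢
    rw [sum_norm_sq_smul, hn', mul_one] at hn
    exact luEquiv_equivalence.symm
      (luEquiv_smul ((pow_eq_one_iff_of_nonneg (norm_nonneg _) two_ne_zero).mp hn) _)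

theorem luClass_eq_iff {ψ φ : Ket qubits} : luClass ψ = luClass φ ↔ LUEquiv ψ φ :=
  Quotient.eq (r := luSetoid)

/-- The norm of a vector in the GHZ class is determined by the quantities that conversions
conserve. -/
theorem CoeffConvertible.sum_norm_sq_eq {g h : Fin 3 → ℝ} (hg : ∀ i, |g i| < 1 / 2)
    (hh : ∀ i, |h i| < 1 / 2) {α β α' β' : ℂ}
    (H : CoeffConvertible (g 0 * g 1 * g 2) α β (h 0 * h 1 * h 2) α' β') :
    ∑ a, ‖gVec h α' β' a‖ ^ 2 = ∑ a, ‖gVec g α β a‖ ^ 2 := by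
  obtain ⟨r, -, hS, hX, -, -⟩ := H
  rw [sum_norm_sq_gVec hh, sum_norm_sq_gVec hg]
  linear_combination -hS / 8 - 2 * hX

/-- Among the states with local parameters `h`, exactly one class is accessible if no local
parameter decreases, and none otherwise. -/
theorem encard_accessible {g h : Fin 3 → ℝ} {z : ℂ} (hG : IsGeneric g z)
    (hh : ∀ i, 0 < h i ∧ h i < 1 / 2) :
    {c ∈ accessibleSet (ghzState g z) |
      ∃ z' : ℂ, z' ≠ 0 ∧ ‖z'‖ ≤ 1 ∧ luClass (ghzState h z') = c}.encard
      = if ∀ i, g i ≤ h i then 1 else 0 := by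
  obtain ⟨α, β, hα, hβ, e, hn, -, h0⟩ := hG.spec
  have ag := hG.abs_lt
  have ah : ∀ i, |h i| < 1 / 2 := fun i => by rw [abs_of_pos (hh i).1]; exact (hh i).2
  have hgp : 0 < g 0 * g 1 * g 2 := mul_pos (mul_pos (hG.1 0).1 (hG.1 1).1) (hG.1 2).1
  have hhp : 0 < h 0 * h 1 * h 2 := mul_pos (mul_pos (hh 0).1 (hh 1).1) (hh 2).1
  rw [e]
  have nec : ∀ c ∈ {c ∈ accessibleSet (gVec g α β) |
      ∃ z' : ℂ, z' ≠ 0 ∧ ‖z'‖ ≤ 1 ∧ luClass (ghzState h z') = c},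
      (∀ i, g i ≤ h i) ∧ ∃ α' β' : ℂ, α' ≠ 0 ∧ β' ≠ 0 ∧ c = luClass (gVec h α' β') ∧
        CoeffConvertible (g 0 * g 1 * g 2) α β (h 0 * h 1 * h 2) α' β' := by
    rintro c ⟨⟨φ, hφ, hR, rfl⟩, z', hz', -, hc⟩
    obtain ⟨α', β', hα', hβ', e', hn', -⟩ := ghzState_spec ah hz'
    rw [e'] at hc
    have := (hR.trans (luClass_eq_iff.mp hc.symm).reaches).necessary ag
      (fun i => ⟨(hh i).1.le, (hh i).2⟩) hα hβ hα' hβ' hn hn'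
    exact ⟨this.1, α', β', hα', hβ', hc.symm, this.2⟩
  split_ifs with hle
  · rw [Set.encard_eq_one]
    obtain ⟨α', β', hα', hβ', H⟩ := exists_target_coeffs (c' := h 0 * h 1 * h 2) hgp
      (mul_le_mul (mul_le_mul (hle 0) (hle 1) (hG.1 1).1.le (hh 0).1.le) (hle 2) (hG.1 2).1.le
        (mul_pos (hh 0).1 (hh 1).1).le) hα hβ h0
    have hR := reaches_of_coeffConvertible (fun i => (hG.1 i).1) hle (fun i => (hh i).2) hα hβ h0 H
    have hn' := (H.sum_norm_sq_eq ag ah).trans hn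
    obtain ⟨z', hz', hz1, hL⟩ := exists_luEquiv_ghzState ah hα' hβ' hn'
    refine ⟨luClass (gVec h α' β'), Set.eq_singleton_iff_unique_mem.mpr ⟨⟨⟨_, ⟨hn',
      not_isProductAcross_gVec ah hα' hβ'⟩, hR, rfl⟩, z', hz', hz1,
      (luClass_eq_iff.mpr hL).symm⟩, fun c hc => ?_⟩⟩
    obtain ⟨-, α'', β'', hα'', hβ'', rfl, H'⟩ := nec c hc
    exact luClass_eq_iff.mpr (luEquiv_of_common_source hgp.ne' hhp.ne' hα'' hβ'' h0 H' H h)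
  · rw [Set.encard_eq_zero, Set.eq_empty_iff_forall_notMem]
    exact fun c hc => hle (nec c hc).1

/-- Among the states with local parameters `h`, exactly one class reaches `Ψ(g, z)` if no `h i`
exceeds `g i` and the product of the `h i` is large enough, and none otherwise. -/
theorem encard_source {g h : Fin 3 → ℝ} {z : ℂ} (hG : IsGeneric g z)
    (hh : ∀ i, 0 < h i ∧ h i < 1 / 2) (hne : h 0 * h 1 * h 2 ≠ fParam z * (g 0 * g 1 * g 2)) :
    {c ∈ sourceSet (ghzState g z) |
      ∃ z' : ℂ, z' ≠ 0 ∧ ‖z'‖ ≤ 1 ∧ luClass (ghzState h z') = c}.encard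
      = if (∀ i, h i ≤ g i) ∧ fParam z * (g 0 * g 1 * g 2) < h 0 * h 1 * h 2 then 1 else 0 := by
  obtain ⟨α, β, hα, hβ, e, hn, hf, h0⟩ := hG.spec
  have ag := hG.abs_lt
  have ah : ∀ i, |h i| < 1 / 2 := fun i => by rw [abs_of_pos (hh i).1]; exact (hh i).2
  have hgp : 0 < g 0 * g 1 * g 2 := mul_pos (mul_pos (hG.1 0).1 (hG.1 1).1) (hG.1 2).1
  have hhp : 0 < h 0 * h 1 * h 2 := mul_pos (mul_pos (hh 0).1 (hh 1).1) (hh 2).1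
  have hs := normSq_add_pos hα β
  rw [e]
  have nec : ∀ c ∈ {c ∈ sourceSet (gVec g α β) |
      ∃ z' : ℂ, z' ≠ 0 ∧ ‖z'‖ ≤ 1 ∧ luClass (ghzState h z') = c},
      (∀ i, h i ≤ g i) ∧ ∃ α' β' : ℂ, α' ≠ 0 ∧ β' ≠ 0 ∧ c = luClass (gVec h α' β') ∧
        CoeffConvertible (h 0 * h 1 * h 2) α' β' (g 0 * g 1 * g 2) α β := by
    rintro c ⟨⟨φ, hφ, hR, rfl⟩, z', hz', -, hc⟩
    obtain ⟨α', β', hα', hβ', e', hn', -⟩ := ghzState_spec ah hz'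
    rw [e'] at hc
    have := ((luClass_eq_iff.mp hc).reaches.trans hR).necessary ah
      (fun i => ⟨(hG.1 i).1.le, (hG.1 i).2⟩) hα' hβ' hα hβ hn' hn
    exact ⟨this.1, α', β', hα', hβ', hc.symm, this.2⟩
  split_ifs with hle
  · rw [Set.encard_eq_one]
    obtain ⟨hle, hlt⟩ := hle
    obtain ⟨α', β', hα', hβ', h0', H⟩ := exists_source_coeffs (c' := g 0 * g 1 * g 2) hhp
      (mul_le_mul (mul_le_mul (hle 0) (hle 1) (hh 1).1.le (hG.1 0).1.le) (hle 2) (hh 2).1.le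
        (mul_pos (hG.1 0).1 (hG.1 1).1).le) hα hβ h0 (by
          rw [hf, ← mul_assoc, mul_comm _ (fParam z)]
          exact mul_lt_mul_of_pos_right hlt hs)
    have hR := reaches_of_coeffConvertible (fun i => (hh i).1) hle (fun i => (hG.1 i).2)
      hα' hβ' h0' H
    have hn' := (H.sum_norm_sq_eq ah ag).symm.trans hn
    obtain ⟨z', hz', hz1, hL⟩ := exists_luEquiv_ghzState ah hα' hβ' hn'
    refine ⟨luClass (gVec h α' β'), Set.eq_singleton_iff_unique_mem.mpr ⟨⟨⟨_, ⟨hn',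
      not_isProductAcross_gVec ah hα' hβ'⟩, hR, rfl⟩, z', hz', hz1,
      (luClass_eq_iff.mpr hL).symm⟩, fun c hc => ?_⟩⟩
    obtain ⟨-, α'', β'', hα'', hβ'', rfl, H'⟩ := nec c hc
    exact luClass_eq_iff.mpr (luEquiv_of_common_target hhp.ne' hgp.ne' hα'' hβ'' h0 H' H h)
  · rw [Set.encard_eq_zero, Set.eq_empty_iff_forall_notMem]
    intro c hc
    obtain ⟨hle', α', β', -, -, -, r, -, hS, hX, -, -⟩ := nec c hc
    refine hle ⟨hle', lt_of_le_of_ne ?_ hne.symm⟩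
    have e' := normSq_add_sq α' β'
    have hb : 2 * |((starRingEnd ℂ) α' * β').re| ≤ normSq α + normSq β := by
      rw [← hS]
      refine le_of_sq_le_sq ?_ (add_nonneg (normSq_nonneg _) (normSq_nonneg _))
      rw [mul_pow, sq_abs, e']
      nlinarith [sq_nonneg (normSq α' - normSq β'), sq_nonneg ((starRingEnd ℂ) α' * β').im]
    apply le_of_mul_le_mul_right _ hs
    calc fParam z * (g 0 * g 1 * g 2) * (normSq α + normSq β)
        = 2 * |g 0 * g 1 * g 2 * ((starRingEnd ℂ) α * β).re| := by
          rw [abs_mul, abs_of_pos hgp]; linear_combination (-(g 0 * g 1 * g 2)) * hf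
      _ = h 0 * h 1 * h 2 * (2 * |((starRingEnd ℂ) α' * β').re|) := by
          rw [← hX, abs_mul, abs_of_pos hhp]; ring
      _ ≤ h 0 * h 1 * h 2 * (normSq α + normSq β) := mul_le_mul_of_nonneg_left hb hhp.le

/-- A state `Ψ(g, z)` with `|z| < 1` is generic, because a slightly smaller first local parameter
gives a state that reaches it. -/
theorem isGeneric_of_norm_lt_one {g : Fin 3 → ℝ} (hg : ∀ i, 0 < g i ∧ g i < 1 / 2) {z : ℂ}
    (hz : z ≠ 0) (hz1 : ‖z‖ < 1) : IsGeneric g z := by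
  refine ⟨hg, hz, hz1.le, fun hM => ?_⟩
  have ag : ∀ i, |g i| < 1 / 2 := fun i => by rw [abs_of_pos (hg i).1]; exact (hg i).2
  obtain ⟨α, β, hα, hβ, e, hn, -, hU⟩ := ghzState_spec ag hz
  have hU : normSq α - normSq β ≠ 0 := fun h => hz1.ne (hU h)
  have hgp : 0 < g 0 * g 1 * g 2 := mul_pos (mul_pos (hg 0).1 (hg 1).1) (hg 2).1
  have hs := normSq_add_pos hα β
  have hlt : 2 * |((starRingEnd ℂ) α * β).re| / (normSq α + normSq β) < 1 := by
    rw [div_lt_one hs]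
    refine lt_of_pow_lt_pow_left₀ 2 hs.le ?_
    rw [mul_pow, sq_abs, normSq_add_sq α β]
    nlinarith [sq_pos_of_ne_zero hU, sq_nonneg ((starRingEnd ℂ) α * β).im]
  obtain ⟨t, ht, ht1⟩ := exists_between hlt
  have ht0 : 0 < t := lt_of_le_of_lt (by positivity) ht
  rw [div_lt_iff₀ hs] at ht
  have hle : ∀ i, Function.update g 0 (t * g 0) i ≤ g i := by
    intro i
    by_cases hi : i = 0
    · subst hi
      simpa using mul_le_of_le_one_left (hg 0).1.le ht1.le
    · simp [hi]
  have hpos : ∀ i, 0 < Function.update g 0 (t * g 0) i := by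
    intro i
    by_cases hi : i = 0
    · subst hi
      simpa using mul_pos ht0 (hg 0).1
    · simpa [hi] using (hg i).1
  have hp : Function.update g 0 (t * g 0) 0 * Function.update g 0 (t * g 0) 1
      * Function.update g 0 (t * g 0) 2 = t * (g 0 * g 1 * g 2) := by
    simp [mul_assoc]
  have ah : ∀ i, |Function.update g 0 (t * g 0) i| < 1 / 2 := fun i => by
    rw [abs_of_pos (hpos i)]; exact (hle i).trans_lt (hg i).2
  obtain ⟨α', β', hα', hβ', h0', H⟩ := exists_source_coeffs (c' := g 0 * g 1 * g 2)
    (mul_pos ht0 hgp) (mul_le_of_le_one_left hgp.le ht1.le) hα hβ (Or.inl hU) (by nlinarith)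
  rw [← hp] at H
  have hR := reaches_of_coeffConvertible hpos hle (fun i => (hg i).2) hα' hβ' h0' H
  have hn' := (H.sum_norm_sq_eq ah ag).symm.trans hn
  rw [e] at hM
  have hL := hM.2 _ ⟨hn', not_isProductAcross_gVec ah hα' hβ'⟩ hR
  have := ((luEquiv_equivalence.symm hL).reaches.necessary ag
    (fun i => ⟨(hpos i).le, (hle i).trans_lt (hg i).2⟩) hα hβ hα' hβ' hn hn').1 0
  simp only [Function.update_self] at this
  nlinarith [(hg 0).1]

end

open MeasureTheory

/-! ### Volumes of the parameter regions -/

theorem setLIntegral_Ioc_ofReal {p q : ℝ} (hpq : p ≤ q) {f F : ℝ → ℝ}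
    (hF : ∀ x ∈ Set.Icc p q, HasDerivAt F (f x) x) (hf : ContinuousOn f (Set.Icc p q))
    (h0 : ∀ x ∈ Set.Icc p q, 0 ≤ f x) :
    ∫⁻ x in Set.Ioc p q, ENNReal.ofReal (f x) = ENNReal.ofReal (F q - F p) := by
  have hf' : ContinuousOn f (Set.uIcc p q) := by rwa [Set.uIcc_of_le hpq]
  have hi := hf'.intervalIntegrable (μ := volume)
  rw [← ofReal_integral_eq_lintegral_ofReal
      ((intervalIntegrable_iff_integrableOn_Ioc_of_le hpq).mp hi),
    ← intervalIntegral.integral_of_le hpq, intervalIntegral.integral_eq_sub_of_hasDerivAt _ hi]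
  · rwa [Set.uIcc_of_le hpq]
  · filter_upwards [ae_restrict_mem measurableSet_Ioc] with x hx
    exact h0 x (Set.Ioc_subset_Icc_self hx)

theorem measurableSet_hyperbola (b c k : ℝ) :
    MeasurableSet {p : ℝ × ℝ | 0 < p.1 ∧ p.1 ≤ b ∧ 0 < p.2 ∧ p.2 ≤ c ∧ k < p.1 * p.2} := by
  measurability

/-- The area of the part of a rectangle above a hyperbola. -/
theorem volume_hyperbola {b c k : ℝ} (hb : 0 < b) (hc : 0 < c) (hk : 0 < k) (hle : k ≤ b * c) :
    volume {p : ℝ × ℝ | 0 < p.1 ∧ p.1 ≤ b ∧ 0 < p.2 ∧ p.2 ≤ c ∧ k < p.1 * p.2}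
      = ENNReal.ofReal (b * c - k - k * Real.log (b * c / k)) := by
  have hkc : 0 < k / c := by positivity
  have hkb : k / c ≤ b := (div_le_iff₀ hc).mpr hle
  rw [Measure.volume_eq_prod, Measure.prod_apply (measurableSet_hyperbola b c k)]
  have key : ∀ y : ℝ, volume (Prod.mk y ⁻¹'
      {p : ℝ × ℝ | 0 < p.1 ∧ p.1 ≤ b ∧ 0 < p.2 ∧ p.2 ≤ c ∧ k < p.1 * p.2})
      = (Set.Ioc (k / c) b).indicator (fun y => ENNReal.ofReal (c - k / y)) y := by
    intro y
    by_cases hy : y ∈ Set.Ioc (k / c) b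
    · have hy0 : 0 < y := hkc.trans hy.1
      rw [Set.indicator_of_mem hy, ← Real.volume_Ioc]
      congr 1
      ext z
      simp only [Set.mem_preimage, Set.mem_ofPred_eq, Set.mem_Ioc, div_lt_iff₀ hy0]
      constructor
      · rintro ⟨-, -, -, h1, h2⟩
        exact ⟨by linarith, h1⟩
      · rintro ⟨h1, h2⟩
        refine ⟨hy0, hy.2, ?_, h2, by linarith⟩
        by_contra! hz
        nlinarith
    · rw [Set.indicator_of_notMem hy]
      convert measure_empty (μ := (volume : Measure ℝ))
      rw [Set.eq_empty_iff_forall_notMem]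
      rintro z ⟨h1, h2, h3, h4, h5⟩
      refine hy ⟨?_, h2⟩
      rw [div_lt_iff₀ hc]
      simp only at h1 h2 h3 h4 h5
      calc k < y * z := h5
        _ ≤ y * c := by gcongr
  simp only [key]
  rw [lintegral_indicator measurableSet_Ioc]
  rw [setLIntegral_Ioc_ofReal hkb (F := fun y => c * y - k * Real.log y)]
  · congr 1
    rw [show b * c / k = b / (k / c) by field_simp, Real.log_div hb.ne' hkc.ne']
    field_simp
    ring
  · intro y hy
    have hy0 : 0 < y := hkc.trans_le hy.1
    have := ((hasDerivAt_id y).const_mul c).sub ((Real.hasDerivAt_log hy0.ne').const_mul k)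
    exact this.congr_deriv (by rw [mul_one, div_eq_mul_inv])
  · refine continuousOn_const.sub (continuousOn_const.div continuousOn_id fun y hy => ?_)
    exact (hkc.trans_le hy.1).ne'
  · intro y hy
    have hy0 : 0 < y := hkc.trans_le hy.1
    rw [sub_nonneg, div_le_iff₀ hy0]
    have := (div_le_iff₀ hc).mp hy.1
    linarith

/-- The coordinates of a vector with three entries. -/
def piThree : (Fin 3 → ℝ) ≃ᵐ ℝ × ℝ × ℝ :=
  (MeasurableEquiv.piFinSuccAbove (fun _ : Fin 3 => ℝ) 0).trans
    ((MeasurableEquiv.refl ℝ).prodCongr MeasurableEquiv.finTwoArrow)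

theorem piThree_apply (h : Fin 3 → ℝ) : piThree h = (h 0, h 1, h 2) := rfl

theorem volume_preserving_piThree : MeasurePreserving piThree volume volume :=
  (volume_preserving_piFinSuccAbove (fun _ : Fin 3 => ℝ) 0).trans
    ((MeasurePreserving.id volume).prod (volume_preserving_finTwoArrow ℝ))

/-- The volume of the part of a box in which the product of the coordinates exceeds `k`. -/
theorem volume_prod_gt {a b c k : ℝ} (ha : 0 < a) (hb : 0 < b) (hc : 0 < c) (hk : 0 < k)
    (hle : k ≤ a * b * c) :
    volume {p : ℝ × ℝ × ℝ | 0 < p.1 ∧ p.1 ≤ a ∧ 0 < p.2.1 ∧ p.2.1 ≤ b ∧ 0 < p.2.2 ∧ p.2.2 ≤ c ∧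
        k < p.1 * p.2.1 * p.2.2}
      = ENNReal.ofReal (a * b * c - k - k * Real.log (a * b * c / k)
          - k / 2 * Real.log (a * b * c / k) ^ 2) := by
  have hbc : 0 < b * c := mul_pos hb hc
  have hkc : 0 < k / (b * c) := by positivity
  have hkb : k / (b * c) ≤ a := (div_le_iff₀ hbc).mpr (by linarith)
  rw [Measure.volume_eq_prod, Measure.prod_apply (by measurability)]
  have key : ∀ x : ℝ, volume (Prod.mk x ⁻¹'
      {p : ℝ × ℝ × ℝ | 0 < p.1 ∧ p.1 ≤ a ∧ 0 < p.2.1 ∧ p.2.1 ≤ b ∧ 0 < p.2.2 ∧ p.2.2 ≤ c ∧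
        k < p.1 * p.2.1 * p.2.2})
      = (Set.Ioc (k / (b * c)) a).indicator (fun x => ENNReal.ofReal
          (b * c - k / x - k / x * Real.log (b * c / (k / x)))) x := by
    intro x
    by_cases hx : x ∈ Set.Ioc (k / (b * c)) a
    · have hx0 : 0 < x := hkc.trans hx.1
      rw [Set.indicator_of_mem hx, ← volume_hyperbola hb hc (div_pos hk hx0)
        ((div_le_iff₀ hx0).mpr (by linarith [(div_lt_iff₀ hbc).mp hx.1]))]
      congr 1
      ext ⟨y, z⟩
      simp only [Set.mem_preimage, Set.mem_ofPred_eq, div_lt_iff₀ hx0]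
      rw [show x * y * z = y * z * x by ring]
      have := hx.2
      tauto
    · rw [Set.indicator_of_notMem hx]
      convert measure_empty (μ := (volume : Measure (ℝ × ℝ)))
      rw [Set.eq_empty_iff_forall_notMem]
      rintro ⟨y, z⟩ ⟨h1, h2, h3, h4, h5, h6, h7⟩
      refine hx ⟨?_, h2⟩
      rw [div_lt_iff₀ hbc]
      simp only at h1 h2 h3 h4 h5 h6 h7
      calc k < x * y * z := h7
        _ = x * (y * z) := by ring
        _ ≤ x * (b * c) := by gcongr
  simp only [key]
  rw [lintegral_indicator measurableSet_Ioc]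
  rw [setLIntegral_Ioc_ofReal hkb (F := fun x => b * c * x - k * Real.log x
    - k / 2 * Real.log (b * c / k * x) ^ 2)]
  · congr 1
    have e1 : b * c / k * (k / (b * c)) = 1 := by field_simp
    have e2 : b * c / k * a = a * b * c / k := by field_simp
    have e3 : Real.log (a * b * c / k) = Real.log a - Real.log (k / (b * c)) := by
      rw [← Real.log_div ha.ne' hkc.ne']
      congr 1
      field_simp
    simp only [e1, e2, Real.log_one]
    have e4 : b * c * (k / (b * c)) = k := by field_simp
    rw [e4]
    linear_combination k * e3
  · intro x hx
    have hx0 : 0 < x := hkc.trans_le hx.1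
    have hl : HasDerivAt (fun x => Real.log (b * c / k * x)) (1 / x) x := by
      have := ((hasDerivAt_id x).const_mul (b * c / k)).log (by positivity)
      exact this.congr_deriv (by simp only [id]; field_simp)
    have := (((hasDerivAt_id x).const_mul (b * c)).sub
      ((Real.hasDerivAt_log hx0.ne').const_mul k)).sub ((hl.pow 2).const_mul (k / 2))
    refine this.congr_deriv ?_
    rw [show b * c / (k / x) = b * c / k * x by field_simp]
    push_cast
    field_simp
  · have hne : ∀ x ∈ Set.Icc (k / (b * c)) a, x ≠ 0 := fun x hx => (hkc.trans_le hx.1).ne'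
    have h1 : ContinuousOn (fun x : ℝ => k / x) (Set.Icc (k / (b * c)) a) :=
      continuousOn_const.div continuousOn_id hne
    have h2 : ContinuousOn (fun x : ℝ => b * c / (k / x)) (Set.Icc (k / (b * c)) a) :=
      continuousOn_const.div h1 fun x hx => div_ne_zero hk.ne' (hne x hx)
    exact (continuousOn_const.sub h1).sub (h1.mul (h2.log fun x hx =>
      div_ne_zero hbc.ne' (div_ne_zero hk.ne' (hne x hx))))
  · intro x hx
    have hx0 : 0 < x := hkc.trans_le hx.1
    have hkx : 0 < k / x := div_pos hk hx0
    have := Real.log_le_sub_one_of_pos (show 0 < b * c / (k / x) by positivity)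
    have h2 := mul_le_mul_of_nonneg_left this hkx.le
    have e : k / x * (b * c / (k / x) - 1) = b * c - k / x := by field_simp
    rw [e] at h2
    linarith

theorem ae_prod_ne {k : ℝ} : ∀ᵐ h : Fin 3 → ℝ, (∀ i, h i ≠ 0) ∧ h 0 * h 1 * h 2 ≠ k := by
  have h1 : ∀ᵐ h : Fin 3 → ℝ, ∀ i, h i ≠ 0 := by
    rw [ae_all_iff]
    intro i
    rw [ae_iff]
    simp only [not_not]
    exact Measure.pi_hyperplane (fun _ : Fin 3 => (volume : Measure ℝ)) i 0
  have hm : MeasurableSet {p : ℝ × ℝ × ℝ | p.1 * p.2.1 ≠ 0 ∧ p.1 * p.2.1 * p.2.2 = k} := by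
    refine (measurableSet_eq_fun ?_ ?_).compl.inter (measurableSet_eq_fun ?_ ?_) <;> fun_prop
  have h2 : volume {p : ℝ × ℝ × ℝ | p.1 * p.2.1 ≠ 0 ∧ p.1 * p.2.1 * p.2.2 = k} = 0 := by
    rw [Measure.volume_eq_prod, Measure.measure_prod_null hm]
    refine Filter.Eventually.of_forall fun x => ?_
    change volume _ = 0
    rw [Measure.volume_eq_prod, Measure.measure_prod_null (measurable_prodMk_left hm)]
    refine Filter.Eventually.of_forall fun y => ?_
    refine measure_mono_null (t := {k / (x * y)}) ?_ Real.volume_singleton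
    rintro z ⟨h0, h⟩
    simp only at h0 h
    rw [Set.mem_singleton_iff, eq_div_iff h0]
    linarith
  have h3 := volume_preserving_piThree.measure_preimage hm.nullMeasurableSet
  rw [h2] at h3
  have h4 : ∀ᵐ h : Fin 3 → ℝ, ¬ (h 0 * h 1 ≠ 0 ∧ h 0 * h 1 * h 2 = k) := by
    rw [ae_iff]
    simp only [not_not]
    exact h3
  filter_upwards [h1, h4] with h h1 h4
  exact ⟨h1, fun h5 => h4 ⟨mul_ne_zero (h1 0) (h1 1), h5⟩⟩

/-- The null set of local parameters with some `h i = 0` or with product `k` does not affect the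
volume, so a set of classes that contains at most one class for each of the other local parameters
has as its volume the measure of those at which it contains one. -/
theorem volume3_eq {S : Set LUClass} {k : ℝ} {p : (Fin 3 → ℝ) → Prop} [DecidablePred p]
    (hp : MeasurableSet {h | p h})
    (H : ∀ h : Fin 3 → ℝ, (∀ i, 0 < h i ∧ h i < 1 / 2) → h 0 * h 1 * h 2 ≠ k →
      {c ∈ S | ∃ z : ℂ, z ≠ 0 ∧ ‖z‖ ≤ 1 ∧ luClass (ghzState h z) = c}.encard
        = if p h then 1 else 0) :
    volume3 S = volume ({h | p h} ∩ Set.univ.pi fun _ : Fin 3 => Set.Ico (0 : ℝ) (1 / 2)) := by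
  have hbox : MeasurableSet (Set.univ.pi fun _ : Fin 3 => Set.Ico (0 : ℝ) (1 / 2)) :=
    MeasurableSet.univ_pi fun _ => measurableSet_Ico
  rw [volume3, ← Measure.restrict_apply hp, ← lintegral_indicator_one hp]
  refine lintegral_congr_ae ?_
  filter_upwards [ae_restrict_mem hbox, ae_restrict_of_ae (ae_prod_ne (k := k))] with h hh hne
  rw [H h (fun i => ⟨lt_of_le_of_ne (hh i trivial).1 (hne.1 i).symm, (hh i trivial).2⟩) hne.2]
  by_cases hph : p h <;> simp [Set.indicator, hph]

theorem accessibleVolume_eq {g : Fin 3 → ℝ} {z : ℂ} (hG : IsGeneric g z) :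
    accessibleVolume (ghzState g z)
      = ENNReal.ofReal ((1 / 2 - g 0) * (1 / 2 - g 1) * (1 / 2 - g 2)) := by
  have hpos : ∀ i, 0 ≤ 1 / 2 - g i := fun i => by linarith [(hG.1 i).2]
  rw [accessibleVolume, volume3_eq (k := 0) (p := fun h => ∀ i, g i ≤ h i)
    (measurableSet_Ici (a := g)) fun h hh _ => encard_accessible hG hh]
  have : {h : Fin 3 → ℝ | ∀ i, g i ≤ h i} ∩ Set.univ.pi (fun _ => Set.Ico (0 : ℝ) (1 / 2))
      = Set.univ.pi fun i => Set.Ico (g i) (1 / 2) := by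
    ext h
    simp only [Set.mem_inter_iff, Set.mem_ofPred_eq, Set.mem_univ_pi, Set.mem_Ico]
    exact ⟨fun H i => ⟨H.1 i, (H.2 i).2⟩,
      fun H => ⟨fun i => (H i).1, fun i => ⟨(hG.1 i).1.le.trans (H i).1, (H i).2⟩⟩⟩
  rw [this, Real.volume_pi_Ico, Fin.prod_univ_three, ← ENNReal.ofReal_mul (hpos 0),
    ← ENNReal.ofReal_mul (mul_nonneg (hpos 0) (hpos 1))]

theorem sourceVolume_eq {g : Fin 3 → ℝ} {z : ℂ} (hG : IsGeneric g z) :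
    0 ≤ g 0 * g 1 * g 2 *
        (1 + fParam z * (Real.log (fParam z) * (1 - 1 / 2 * Real.log (fParam z)) - 1)) ∧
    sourceVolume (ghzState g z)
      = ENNReal.ofReal (g 0 * g 1 * g 2 *
        (1 + fParam z * (Real.log (fParam z) * (1 - 1 / 2 * Real.log (fParam z)) - 1))) := by
  obtain ⟨α, β, hα, hβ, -, -, hf, h0⟩ := hG.spec
  have hgp : 0 < g 0 * g 1 * g 2 := mul_pos (mul_pos (hG.1 0).1 (hG.1 1).1) (hG.1 2).1
  have hf0 : 0 ≤ fParam z := by unfold fParam; positivity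
  have hf1 : fParam z ≤ 1 := by
    have hs := normSq_add_pos hα β
    refine le_of_mul_le_mul_right ?_ hs
    rw [← hf, one_mul]
    refine le_of_sq_le_sq ?_ hs.le
    rw [mul_pow, sq_abs, normSq_add_sq]
    nlinarith [sq_nonneg (Complex.normSq α - Complex.normSq β),
      sq_nonneg ((starRingEnd ℂ) α * β).im]
  have hset : {h : Fin 3 → ℝ | (∀ i, h i ≤ g i) ∧ fParam z * (g 0 * g 1 * g 2) < h 0 * h 1 * h 2}
      ∩ Set.univ.pi (fun _ => Set.Ico (0 : ℝ) (1 / 2))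
      = piThree ⁻¹' {p : ℝ × ℝ × ℝ | 0 < p.1 ∧ p.1 ≤ g 0 ∧ 0 < p.2.1 ∧ p.2.1 ≤ g 1 ∧
          0 < p.2.2 ∧ p.2.2 ≤ g 2 ∧ fParam z * (g 0 * g 1 * g 2) < p.1 * p.2.1 * p.2.2} := by
    ext h
    simp only [Set.mem_inter_iff, Set.mem_ofPred_eq, Set.mem_univ_pi, Set.mem_Ico,
      Set.mem_preimage, piThree_apply]
    constructor
    · rintro ⟨⟨hle, hlt⟩, hb⟩
      have hne : ∏ i, h i ≠ 0 := by
        rw [Fin.prod_univ_three]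
        exact ((mul_nonneg hf0 hgp.le).trans_lt hlt).ne'
      have hpos : ∀ i, 0 < h i := fun i =>
        lt_of_le_of_ne (hb i).1 (Finset.prod_ne_zero_iff.mp hne i (Finset.mem_univ i)).symm
      exact ⟨hpos 0, hle 0, hpos 1, hle 1, hpos 2, hle 2, hlt⟩
    · rintro ⟨h1, h2, h3, h4, h5, h6, h7⟩
      have hle : ∀ i, 0 < h i ∧ h i ≤ g i := by
        intro i
        fin_cases i
        exacts [⟨h1, h2⟩, ⟨h3, h4⟩, ⟨h5, h6⟩]
      exact ⟨⟨fun i => (hle i).2, h7⟩,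
        fun i => ⟨(hle i).1.le, (hle i).2.trans_lt (hG.1 i).2⟩⟩
  have hm : MeasurableSet {p : ℝ × ℝ × ℝ | 0 < p.1 ∧ p.1 ≤ g 0 ∧ 0 < p.2.1 ∧ p.2.1 ≤ g 1 ∧
      0 < p.2.2 ∧ p.2.2 ≤ g 2 ∧ fParam z * (g 0 * g 1 * g 2) < p.1 * p.2.1 * p.2.2} := by
    measurability
  have hm' : MeasurableSet {h : Fin 3 → ℝ | (∀ i, h i ≤ g i) ∧
      fParam z * (g 0 * g 1 * g 2) < h 0 * h 1 * h 2} :=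
    (measurableSet_Iic (a := g)).inter (measurableSet_lt measurable_const
      (show Measurable fun h : Fin 3 → ℝ => h 0 * h 1 * h 2 by fun_prop))
  rw [sourceVolume, volume3_eq (k := fParam z * (g 0 * g 1 * g 2))
    (p := fun h => (∀ i, h i ≤ g i) ∧ fParam z * (g 0 * g 1 * g 2) < h 0 * h 1 * h 2)
    hm' fun h hh hne => encard_source hG hh hne, hset,
    volume_preserving_piThree.measure_preimage hm.nullMeasurableSet]
  rcases hf0.eq_or_lt with hz | hz
  · rw [← hz]
    simp only [zero_mul, add_zero, mul_one]
    refine ⟨hgp.le, ?_⟩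
    have : {p : ℝ × ℝ × ℝ | 0 < p.1 ∧ p.1 ≤ g 0 ∧ 0 < p.2.1 ∧ p.2.1 ≤ g 1 ∧
        0 < p.2.2 ∧ p.2.2 ≤ g 2 ∧ 0 < p.1 * p.2.1 * p.2.2}
        = Set.Ioc 0 (g 0) ×ˢ Set.Ioc 0 (g 1) ×ˢ Set.Ioc 0 (g 2) := by
      ext ⟨x, y, w⟩
      simp only [Set.mem_ofPred_eq, Set.mem_prod, Set.mem_Ioc]
      constructor
      · tauto
      · rintro ⟨⟨h1, h2⟩, ⟨h3, h4⟩, h5, h6⟩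
        exact ⟨h1, h2, h3, h4, h5, h6, by positivity⟩
    rw [this, Measure.volume_eq_prod, Measure.prod_prod, Measure.volume_eq_prod, Measure.prod_prod]
    simp only [Real.volume_Ioc, sub_zero]
    rw [mul_assoc, ENNReal.ofReal_mul (hG.1 0).1.le, ENNReal.ofReal_mul (hG.1 1).1.le]
  · have hdiv : g 0 * g 1 * g 2 / (fParam z * (g 0 * g 1 * g 2)) = (fParam z)⁻¹ := by
      rw [div_mul_cancel_right₀ hgp.ne']
    rw [volume_prod_gt (hG.1 0).1 (hG.1 1).1 (hG.1 2).1 (mul_pos hz hgp)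
      (mul_le_of_le_one_left hgp.le hf1), hdiv, Real.log_inv]
    -- Nonnegativity is the bound `1 + L + L ^ 2 / 2 ≤ exp L` at `L = - log f`.
    have hq := Real.quadratic_le_exp_of_nonneg (x := -Real.log (fParam z))
      (neg_nonneg.mpr (Real.log_nonpos hz.le hf1))
    rw [Real.exp_neg, Real.exp_log hz] at hq
    have hq' := mul_le_mul_of_nonneg_left hq hz.le
    rw [mul_inv_cancel₀ hz.ne'] at hq'
    refine ⟨mul_nonneg hgp.le (by linarith), ?_⟩
    congr 1
    ring

/-! ### Suprema and normalised measures -/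

open Filter Topology

/-- At `z = (1 + i) / 4` the square `z²` is imaginary, so that `f_z = 0`. -/
theorem fParam_one_add_I_div_four : fParam ((1 + Complex.I) / 4) = 0 := by
  have : ((1 + Complex.I) / 4) ^ 2 = ((1 / 8 : ℝ) : ℂ) * Complex.I := by
    push_cast
    linear_combination Complex.I_sq / 16
  rw [fParam, this, Complex.re_ofReal_mul, Complex.I_re]
  simp

theorem isGeneric_one_add_I_div_four {x : ℝ} (hx : 0 < x ∧ x < 1 / 2) :
    IsGeneric (fun _ => x) ((1 + Complex.I) / 4) := by
  refine isGeneric_of_norm_lt_one (fun _ => hx) (fun h => ?_) ?_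
  · have := congrArg Complex.re h
    norm_num at this
  · rw [norm_div]
    have h1 := norm_add_le (1 : ℂ) Complex.I
    rw [norm_one, Complex.norm_I] at h1
    norm_num
    linarith

theorem accessibleVolumeSup_eq : accessibleVolumeSup = 1 / 8 := by
  have h8 : (1 / 8 : ℝ≥0∞) = ENNReal.ofReal (1 / 8) := by
    rw [ENNReal.ofReal_div_of_pos (by norm_num)]
    simp
  refine le_antisymm (iSup_le fun g => iSup_le fun z => iSup_le fun hG => ?_) ?_
  · rw [accessibleVolume_eq hG, h8]
    refine ENNReal.ofReal_le_ofReal ?_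
    have h := fun i => hG.1 i
    have h0 := fun i => sub_nonneg.mpr (h i).2.le
    have h1 := fun i => sub_le_self (1 / 2 : ℝ) (h i).1.le
    calc (1 / 2 - g 0) * (1 / 2 - g 1) * (1 / 2 - g 2) ≤ 1 / 2 * (1 / 2) * (1 / 2) :=
          mul_le_mul (mul_le_mul (h1 0) (h1 1) (h0 1) (by norm_num)) (h1 2) (h0 2) (by norm_num)
      _ = 1 / 8 := by norm_num
  · have hlim : Tendsto (fun x : ℝ => ENNReal.ofReal ((1 / 2 - x) * (1 / 2 - x) * (1 / 2 - x)))
        (𝓝[>] 0) (𝓝 (1 / 8)) := by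
      rw [h8]
      refine tendsto_nhdsWithin_of_tendsto_nhds
        ((ENNReal.continuous_ofReal.comp (by fun_prop)).tendsto' _ _ ?_)
      norm_num
    refine le_of_tendsto hlim ?_
    filter_upwards [Ioo_mem_nhdsGT (show (0 : ℝ) < 1 / 2 by norm_num)] with x hx
    have hG := isGeneric_one_add_I_div_four hx
    rw [← accessibleVolume_eq hG]
    exact le_iSup_of_le _ (le_iSup_of_le _ (le_iSup_of_le hG le_rfl))

theorem sourceVolumeSup_eq : sourceVolumeSup = 1 / 8 := by
  have h8 : (1 / 8 : ℝ≥0∞) = ENNReal.ofReal (1 / 8) := by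
    rw [ENNReal.ofReal_div_of_pos (by norm_num)]
    simp
  refine le_antisymm (iSup_le fun g => iSup_le fun z => iSup_le fun hG => ?_) ?_
  · rw [(sourceVolume_eq hG).2, h8]
    refine ENNReal.ofReal_le_ofReal ?_
    have h := fun i => hG.1 i
    have hgp : 0 ≤ g 0 * g 1 * g 2 := (mul_pos (mul_pos (h 0).1 (h 1).1) (h 2).1).le
    have hf0 : 0 ≤ fParam z := by unfold fParam; positivity
    have hf : fParam z * (Real.log (fParam z) * (1 - 1 / 2 * Real.log (fParam z)) - 1) ≤ 0 :=
      mul_nonpos_of_nonneg_of_nonpos hf0 (by nlinarith [sq_nonneg (Real.log (fParam z) - 1)])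
    calc _ ≤ g 0 * g 1 * g 2 * 1 := by gcongr; linarith
      _ ≤ 1 / 2 * (1 / 2) * (1 / 2) * 1 := by
          gcongr <;> first | exact (h _).2.le | exact (h _).1.le
      _ = 1 / 8 := by norm_num
  · have hlim : Tendsto (fun x : ℝ => ENNReal.ofReal (x * x * x)) (𝓝[<] (1 / 2)) (𝓝 (1 / 8)) := by
      rw [h8]
      refine tendsto_nhdsWithin_of_tendsto_nhds
        ((ENNReal.continuous_ofReal.comp (by fun_prop)).tendsto' _ _ ?_)
      norm_num
    refine le_of_tendsto hlim ?_
    filter_upwards [Ioo_mem_nhdsLT (show (0 : ℝ) < 1 / 2 by norm_num)] with x hx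
    have hG := isGeneric_one_add_I_div_four hx
    have hV := (sourceVolume_eq hG).2
    rw [fParam_one_add_I_div_four, zero_mul, add_zero, mul_one] at hV
    rw [← hV]
    exact le_iSup_of_le _ (le_iSup_of_le _ (le_iSup_of_le hG le_rfl))

end ThreeQubit

theorem mainTheorem2 :
    (∀ (g : Fin 3 → ℝ) (z : ℂ), IsGeneric g z →
      (accessibleVolume (ghzState g z) ≠ ⊤ ∧
        (accessibleVolume (ghzState g z)).toReal
          = (1 / 2 - g 0) * (1 / 2 - g 1) * (1 / 2 - g 2)) ∧
      (sourceVolume (ghzState g z) ≠ ⊤ ∧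
        (sourceVolume (ghzState g z)).toReal
          = g 0 * g 1 * g 2 *
            (1 + fParam z *
              (Real.log (fParam z) * (1 - 1 / 2 * Real.log (fParam z)) - 1)))) ∧
    accessibleVolumeSup = 1 / 8 ∧
    sourceVolumeSup = 1 / 8 ∧
    (∀ (g : Fin 3 → ℝ) (z : ℂ), IsGeneric g z →
      accessibleEntanglement (ghzState g z) = 8 * (accessibleVolume (ghzState g z)).toReal ∧
      sourceEntanglement (ghzState g z) = 1 - 8 * (sourceVolume (ghzState g z)).toReal) := by
  refine ⟨fun g z hG => ⟨?_, ?_⟩, accessibleVolumeSup_eq, sourceVolumeSup_eq, fun g z _ => ?_⟩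
  · have hpos : ∀ i, 0 ≤ 1 / 2 - g i := fun i => by linarith [(hG.1 i).2]
    rw [accessibleVolume_eq hG]
    exact ⟨ENNReal.ofReal_ne_top,
      ENNReal.toReal_ofReal (mul_nonneg (mul_nonneg (hpos 0) (hpos 1)) (hpos 2))⟩
  · obtain ⟨h0, hV⟩ := sourceVolume_eq hG
    rw [hV]
    exact ⟨ENNReal.ofReal_ne_top, ENNReal.toReal_ofReal h0⟩
  · rw [accessibleEntanglement, sourceEntanglement, accessibleVolumeSup_eq, sourceVolumeSup_eq,
      ENNReal.toReal_div, ENNReal.toReal_div]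
    norm_num
    constructor <;> ring
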